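/- Let $X_1,X_2$ be independent, almost surely positive random variables such that, for $i=1,2$, $$P(X_i>x)\sim g_i(x)\exp(-L_ix^{p_i}),\qquad x\to\infty,$$ where $L_i,p_i>0$ are constants and $g_i$ is regularly varying at infinity with some index $\alpha_i\in\mathbb R$ (i.e. $g_i$ is positive and measurable on some half-line $(X,\infty)$, and $g_i(tx)/g_i(x)\to t^{\alpha_i}$ as $x\to\infty$ for every $t>0$) and ultimately monotone (non-decreasing or non-increasing on some half-line). Here $a(x)\sim b(x)$ means $a(x)/b(x)\to1$ as $x\to\infty$. Put $$A=\Bigl(\frac{p_1L_1}{p_2L_2}\Bigr)^{1/(p_1+p_2)},\qquad B=L_1A^{-p_1}+L_2A^{p_2},\qquad z_x=A\,x^{p_1/(p_1+p_2)},\qquad Z=X_1X_2.$$ Then $$P(Z>x)\sim\Bigl(\frac{2\pi p_2L_2}{p_1+p_2}\Bigr)^{1/2}A^{p_2/2}\,x^{\frac{p_1p_2}{2(p_1+p_2)}}\,g_1(x/z_x)\,g_2(z_x)\,\exp\bigl(-B\,x^{\frac{p_1p_2}{p_1+p_2}}\bigr).$$ Suppose moreover that $X_1$ has a probability density $h_1$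 that is bounded, non-increasing on some half-line, and satisfies $h_1(x)\sim L_1p_1x^{p_1-1}P(X_1>x)$. Then $Z$ has a density, one version of it is $$h(x)=\int_{(0,\infty)}\frac1y\,h_1(x/y)\,dF_2(y)$$ ($F_2$ being the distribution function of $X_2$; the integral converges for every $x>0$), and $$h(x)\sim L_1p_1A^{-p_1}x^{\frac{p_1p_2}{p_1+p_2}-1}P(Z>x).$$ Any other version of the density of $Z$ satisfies the same relation as $x\to\infty$ outside a Lebesgue-null set. -/

import Mathlib

open MeasureTheory ProbabilityTheory Filter Topology Asymptotics

noncomputable section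

namespace WeibullProduct

/-- `g` is regularly varying at infinity with index `α`: it is positive and measurable on some
half-line `(X, ∞)` and `g (t x) / g x → t ^ α` as `x → ∞`, for every `t > 0`.
The values of `g` on any bounded set are irrelevant. -/
def RegularlyVarying (g : ℝ → ℝ) (α : ℝ) : Prop :=
  (∃ X : ℝ, (∀ x, X < x → 0 < g x) ∧ Measurable ((Set.Ioi X).domRestrict g)) ∧
    ∀ t : ℝ, 0 < t → Tendsto (fun x => g (t * x) / g x) atTop (𝓝 (t ^ α))

/-- `g` is non-increasing on some half-line `[X, ∞)`. -/
def UltimatelyDecreasing (g : ℝ → ℝ) : Prop :=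
  ∃ X : ℝ, AntitoneOn g (Set.Ici X)

/-- `g` is non-decreasing on some half-line, or non-increasing on some half-line. -/
def UltimatelyMonotone (g : ℝ → ℝ) : Prop :=
  (∃ X : ℝ, MonotoneOn g (Set.Ici X)) ∨ UltimatelyDecreasing g

/-- The survival function `x ↦ P(X > x)` of a random variable. -/
def tail {Ω : Type*} [MeasurableSpace Ω] (P : Measure Ω) (X : Ω → ℝ) (x : ℝ) : ℝ :=
  P.real {ω | x < X ω}

/-- `X` is a positive risk with `P(X > x) ∼ g(x) exp(-L x ^ p)` as `x → ∞`, where `L, p > 0` and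
`g` is regularly varying at infinity with index `α`. -/
structure IsWeibullType {Ω : Type*} [MeasurableSpace Ω] (P : Measure Ω) (X : Ω → ℝ)
    (g : ℝ → ℝ) (α L p : ℝ) : Prop where
  measurable : Measurable X
  pos : ∀ᵐ ω ∂P, 0 < X ω
  L_pos : 0 < L
  p_pos : 0 < p
  regularlyVarying : RegularlyVarying g α
  tail_equiv : tail P X ~[atTop] fun x => g x * Real.exp (-L * x ^ p)

/-- The function `h` is (a version of) the probability density of the law `μ` on the line. -/
structure IsDensity (μ : Measure ℝ) (h : ℝ → ℝ) : Prop where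
  measurable : Measurable h
  nonneg : ∀ x, 0 ≤ h x
  eq_withDensity : μ = volume.withDensity fun x => ENNReal.ofReal (h x)

/-- The usual version `x ↦ ∫₀^∞ h₁(x/y) y⁻¹ dF₂(y)` of the density of the product of a variable
with density `h₁` and an independent positive variable with law `μ₂`. -/
def productDensity (h₁ : ℝ → ℝ) (μ₂ : Measure ℝ) (x : ℝ) : ℝ :=
  ∫ y in Set.Ioi 0, h₁ (x / y) / y ∂μ₂

/-- `A = ((p₁ L₁) / (p₂ L₂)) ^ (1 / (p₁ + p₂))`. -/
def constA (L₁ p₁ L₂ p₂ : ℝ) : ℝ := ((p₁ * L₁) / (p₂ * L₂)) ^ (1 / (p₁ + p₂))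

/-- `B = L₁ A ^ (-p₁) + L₂ A ^ p₂`. -/
def constB (L₁ p₁ L₂ p₂ : ℝ) : ℝ :=
  L₁ * constA L₁ p₁ L₂ p₂ ^ (-p₁) + L₂ * constA L₁ p₁ L₂ p₂ ^ p₂

/-- `z_x = A x ^ (p₁ / (p₁ + p₂))`. -/
def zfun (L₁ p₁ L₂ p₂ x : ℝ) : ℝ := constA L₁ p₁ L₂ p₂ * x ^ (p₁ / (p₁ + p₂))

end WeibullProduct

end

/-! Conditioning on `X₂` gives `P(Z > x) = ∫ P(X₁ > x/y) dF₂(y)`. On the exponential scale the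
integrand costs `L₁ (x/y)^p₁ + L₂ y^p₂`, which is minimal at `y = z_x` and grows quadratically in
`log (y / z_x)` (`exponent_ge`).

A Chernoff bound discards every `y` with `|log (y / z_x)| > δ` (`setIntegral_far_negligible`). On
the remaining window `g₁(x/y)` is nearly constant, so `g₁` is frozen at `x / z_x`
(`mixture_isEquivalent`). This needs only exponential moments and a crude lower tail bound for `F₂`.

What remains, `∫ exp(-L₁ (x/y)^p₁) dF₂(y)`, is the tail of a product of `X₂` with a pure Weibull
variable. By Fubini the two factors trade places, and the same freezing lemma puts `g₂` at `z_x`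
(`weibull_mixture_isEquivalent`). The product of two pure Weibull variables is left to Laplace's
method.

For the density, `x h(x)` is again such a mixture, with kernel `u h₁(u)`. Freezing yields the same
pure integral as for the tail, so only the frozen factors are compared. -/

namespace WeibullProduct

/-! ### Regularly varying factors: oscillation and growth -/

/-- `g` is eventually positive and `g (eˢ x) / g x` is uniformly close to one for small `s` and
large `x` (intermediate regular variation). -/
structure IntermediateRV (g : ℝ → ℝ) : Prop where
  pos : ∀ᶠ x in atTop, 0 < g x
  osc : ∀ ε : ℝ, 0 < ε → ∃ δ : ℝ, 0 < δ ∧ ∀ᶠ x in atTop, ∀ s : ℝ, |s| ≤ δ →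
    Real.exp (-ε) * g x ≤ g (Real.exp s * x) ∧ g (Real.exp s * x) ≤ Real.exp ε * g x

/-- Monotonicity sandwiches `g (eˢ x)`, `|s| ≤ δ`, between the values at the two extreme scales
`e^{±δ}`. Two pointwise limits thus replace a uniform convergence theorem. -/
theorem RegularlyVarying.intermediateRV {g : ℝ → ℝ} {α : ℝ} (h : RegularlyVarying g α)
    (hm : UltimatelyMonotone g) : IntermediateRV g := by
  obtain ⟨⟨X, hX, -⟩, hlim⟩ := h
  have hpos : ∀ᶠ x in atTop, 0 < g x := (eventually_gt_atTop X).mono hX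
  refine ⟨hpos, fun ε hε => ?_⟩
  obtain ⟨δ, hδ, hδα⟩ : ∃ δ : ℝ, 0 < δ ∧ δ * |α| < ε :=
    ⟨ε / (|α| + 1), by positivity, by
      rw [div_mul_eq_mul_div, div_lt_iff₀ (by positivity)]; nlinarith [abs_nonneg α]⟩
  have key : ∀ s : ℝ, |s| ≤ δ → ∀ᶠ x in atTop,
      Real.exp (-ε) * g x ≤ g (Real.exp s * x) ∧ g (Real.exp s * x) ≤ Real.exp ε * g x := by
    intro s hs
    have hsα : |s * α| < ε := by
      rw [abs_mul]; exact lt_of_le_of_lt (mul_le_mul_of_nonneg_right hs (abs_nonneg _)) hδα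
    have hl := hlim (Real.exp s) (Real.exp_pos s)
    rw [← Real.exp_mul] at hl
    have h1 : Real.exp (-ε) < Real.exp (s * α) := Real.exp_lt_exp.2 (abs_lt.1 hsα).1
    have h2 : Real.exp (s * α) < Real.exp ε := Real.exp_lt_exp.2 (abs_lt.1 hsα).2
    filter_upwards [hl.eventually (Ioo_mem_nhds h1 h2), hpos] with x hx hg
    rw [lt_div_iff₀ hg, div_lt_iff₀ hg] at hx
    exact ⟨hx.1.le, hx.2.le⟩
  refine ⟨δ, hδ, ?_⟩
  have hexp : ∀ {s x : ℝ}, |s| ≤ δ → 0 ≤ x →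
      Real.exp (-δ) * x ≤ Real.exp s * x ∧ Real.exp s * x ≤ Real.exp δ * x := fun hs hx =>
    ⟨mul_le_mul_of_nonneg_right (Real.exp_le_exp.2 (abs_le.1 hs).1) hx,
      mul_le_mul_of_nonneg_right (Real.exp_le_exp.2 (abs_le.1 hs).2) hx⟩
  have hbig : ∀ Y : ℝ, ∀ᶠ x in atTop, Y ≤ Real.exp (-δ) * x := fun Y =>
    (tendsto_id.const_mul_atTop (Real.exp_pos _)).eventually_ge_atTop Y
  have k1 := key δ (abs_of_pos hδ).le
  have k2 := key (-δ) (by rw [abs_neg, abs_of_pos hδ])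
  rcases hm with ⟨Y, hY⟩ | ⟨Y, hY⟩
  · filter_upwards [k1, k2, hbig Y, eventually_ge_atTop 0] with x h1 h2 h3 h0 s hs
    obtain ⟨e1, e2⟩ := hexp hs h0
    exact ⟨h2.1.trans (hY h3 (h3.trans e1) e1),
      (hY (h3.trans e1) (h3.trans (e1.trans e2)) e2).trans h1.2⟩
  · filter_upwards [k1, k2, hbig Y, eventually_ge_atTop 0] with x h1 h2 h3 h0 s hs
    obtain ⟨e1, e2⟩ := hexp hs h0
    exact ⟨h1.1.trans (hY (h3.trans e1) (h3.trans (e1.trans e2)) e2),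
      (hY h3 (h3.trans e1) e1).trans h2.2⟩

theorem IntermediateRV.mul {f g : ℝ → ℝ} (hf : IntermediateRV f) (hg : IntermediateRV g) :
    IntermediateRV fun x => f x * g x := by
  refine ⟨by filter_upwards [hf.pos, hg.pos] with x h1 h2 using mul_pos h1 h2, fun ε hε => ?_⟩
  obtain ⟨δ, hδ, h1⟩ := hf.osc (ε / 2) (by positivity)
  obtain ⟨δ', hδ', h2⟩ := hg.osc (ε / 2) (by positivity)
  refine ⟨min δ δ', lt_min hδ hδ', ?_⟩
  filter_upwards [h1, h2, hf.pos, hg.pos] with x h1 h2 hf hg s hs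
  obtain ⟨a1, a2⟩ := h1 s (hs.trans (min_le_left _ _))
  obtain ⟨b1, b2⟩ := h2 s (hs.trans (min_le_right _ _))
  have e1 : Real.exp (-ε) = Real.exp (-(ε / 2)) * Real.exp (-(ε / 2)) := by
    rw [← Real.exp_add]; ring_nf
  have e2 : Real.exp ε = Real.exp (ε / 2) * Real.exp (ε / 2) := by
    rw [← Real.exp_add]; ring_nf
  have p1 : 0 ≤ Real.exp (-(ε / 2)) * f x := by positivity
  have p2 : 0 ≤ Real.exp (-(ε / 2)) * g x := by positivity
  rw [e1, e2, mul_mul_mul_comm, mul_mul_mul_comm (Real.exp (ε / 2))]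
  exact ⟨mul_le_mul a1 b1 p2 (p1.trans a1), mul_le_mul a2 b2 (p2.trans b1) (by positivity)⟩

theorem intermediateRV_const_mul_rpow {a b : ℝ} (ha : 0 < a) (hb : 0 < b) :
    IntermediateRV fun x => a * x ^ b := by
  refine ⟨?_, fun ε hε => ⟨ε / b, by positivity, ?_⟩⟩
  · filter_upwards [eventually_gt_atTop 0] with x hx
    positivity
  · filter_upwards [eventually_gt_atTop 0] with x hx s hs
    rw [Real.mul_rpow (Real.exp_pos _).le hx.le, ← Real.exp_mul, mul_left_comm a]
    have hs' : |s * b| ≤ ε := by rwa [abs_mul, abs_of_pos hb, ← le_div_iff₀ hb]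
    have hp : 0 ≤ a * x ^ b := by positivity
    constructor <;> gcongr
    · exact (abs_le.1 hs').1
    · exact (abs_le.1 hs').2

/-- Each multiplicative step of size at most `e^δ` changes `log g` by at most 1, and reaching `x`
takes `O(log x)` steps. -/
theorem IntermediateRV.log_isLittleO {g : ℝ → ℝ} (hg : IntermediateRV g) {p : ℝ} (hp : 0 < p) :
    (fun x => Real.log (g x)) =o[atTop] fun x => x ^ p := by
  obtain ⟨δ, hδ, hosc⟩ := hg.osc 1 one_pos
  obtain ⟨X, hX⟩ := eventually_atTop.1 (hosc.and hg.pos)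
  set Y := max X 1
  have hY0 : 0 < Y := lt_of_lt_of_le one_pos (le_max_right _ _)
  have hXY : X ≤ Y := le_max_left _ _
  have step : ∀ s : ℝ, 0 ≤ s → s ≤ δ → ∀ n : ℕ,
      |Real.log (g (Real.exp (n * s) * Y)) - Real.log (g Y)| ≤ n := by
    intro s hs0 hs n
    induction n with
    | zero => simp
    | succ n ih =>
      have hle : Y ≤ Real.exp (n * s) * Y := by
        have : 1 ≤ Real.exp (n * s) := Real.one_le_exp (by positivity)
        nlinarith
      obtain ⟨h1, h2⟩ := hX _ (hXY.trans hle)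
      obtain ⟨h3, h4⟩ := h1 s (by rwa [abs_of_nonneg hs0])
      have e : Real.exp s * (Real.exp (n * s) * Y) = Real.exp ((n + 1 : ℕ) * s) * Y := by
        rw [← mul_assoc, ← Real.exp_add]; push_cast; ring_nf
      rw [e] at h3 h4
      have hp1 : 0 < g (Real.exp ((n + 1 : ℕ) * s) * Y) := lt_of_lt_of_le (by positivity) h3
      have l1 := Real.log_le_log (by positivity) h3
      have l2 := Real.log_le_log hp1 h4
      rw [Real.log_mul (Real.exp_pos _).ne' h2.ne', Real.log_exp] at l1 l2
      rw [abs_le] at ih ⊢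
      push_cast at *
      constructor <;> linarith
  have bound : ∀ x, Y ≤ x →
      |Real.log (g x)| ≤ |Real.log (g Y)| + 2 + (1 / δ) * (Real.log x - Real.log Y) := by
    intro x hx
    have hx0 : 0 < x := hY0.trans_le hx
    set l := Real.log x - Real.log Y
    have hl : 0 ≤ l := sub_nonneg.2 (Real.log_le_log hY0 hx)
    -- With step `l / n`, exactly `n` steps lead from `Y` to `x`; the extra 1 keeps `n` positive
    -- when `l = 0`.
    set n := ⌈l / δ⌉₊ + 1
    have hn0 : (0 : ℝ) < n := by positivity
    have hn1 : l / δ ≤ n := (Nat.le_ceil _).trans (by simp [n])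
    have hn2 : (n : ℝ) ≤ l / δ + 2 := by
      have := (Nat.ceil_lt_add_one (show 0 ≤ l / δ by positivity)).le
      simp only [n]; push_cast; linarith
    have hs : l / n ≤ δ := by
      rw [div_le_iff₀ hn0]; rwa [div_le_iff₀ hδ, mul_comm] at hn1
    have := step (l / n) (by positivity) hs n
    rw [mul_div_cancel₀ _ hn0.ne', Real.exp_sub, Real.exp_log hx0, Real.exp_log hY0,
      div_mul_cancel₀ _ hY0.ne'] at this
    have h3 := abs_sub_abs_le_abs_sub (Real.log (g x)) (Real.log (g Y))
    have h4 : 1 / δ * l = l / δ := by ring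
    linarith
  have hsmall : (fun x : ℝ => |Real.log (g Y)| + 2 + (1 / δ) * (Real.log x - Real.log Y))
      =o[atTop] fun x => x ^ p := by
    have hc : ∀ c : ℝ, (fun _ : ℝ => c) =o[atTop] fun x : ℝ => x ^ p := fun c =>
      isLittleO_const_left.2 (Or.inr (tendsto_norm_atTop_atTop.comp (tendsto_rpow_atTop hp)))
    exact (hc _).add (((isLittleO_log_rpow_atTop hp).sub (hc _)).const_mul_left _)
  refine IsBigO.trans_isLittleO (IsBigO.of_bound 1 ?_) hsmall
  filter_upwards [eventually_ge_atTop Y] with x hx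
  rw [one_mul, Real.norm_eq_abs, Real.norm_eq_abs]
  exact (bound x hx).trans (le_abs_self _)

theorem IntermediateRV.growth {g : ℝ → ℝ} (hg : IntermediateRV g) {p ε : ℝ} (hp : 0 < p)
    (hε : 0 < ε) :
    ∀ᶠ x in atTop, Real.exp (-ε * x ^ p) ≤ g x ∧ g x ≤ Real.exp (ε * x ^ p) := by
  filter_upwards [(hg.log_isLittleO hp).bound hε, hg.pos, eventually_gt_atTop 0] with x hx h0 hx0
  rw [Real.norm_eq_abs, Real.norm_eq_abs, abs_of_pos (a := x ^ p) (by positivity), abs_le] at hx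
  rw [← Real.le_log_iff_exp_le h0, ← Real.log_le_iff_le_exp h0]
  exact ⟨by linarith, hx.2⟩

/-! ### The exponent and its saddle point -/

/-- Whichever exponential has a nonnegative argument supplies the quadratic term; the tangent line
suffices for the other, and the linear terms cancel. -/
theorem exp_combination_ge {p₁ p₂ : ℝ} (h₁ : 0 < p₁) (h₂ : 0 < p₂) (u : ℝ) :
    1 / p₁ + 1 / p₂ + min p₁ p₂ / 2 * u ^ 2 ≤
      Real.exp (-p₁ * u) / p₁ + Real.exp (p₂ * u) / p₂ := by
  have lin : ∀ {p : ℝ} (_ : 0 < p) (v : ℝ), 1 / p + v ≤ Real.exp (p * v) / p := by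
    intro p hp v
    rw [le_div_iff₀ hp, add_mul, div_mul_cancel₀ _ hp.ne']
    linarith [Real.add_one_le_exp (p * v)]
  have quad : ∀ {p : ℝ} (_ : 0 < p) (v : ℝ), 0 ≤ v →
      1 / p + v + p / 2 * v ^ 2 ≤ Real.exp (p * v) / p := by
    intro p hp v hv
    rw [le_div_iff₀ hp, add_mul, add_mul, div_mul_cancel₀ _ hp.ne']
    have := Real.quadratic_le_exp_of_nonneg (x := p * v) (by positivity)
    nlinarith
  have e : -p₁ * u = p₁ * -u := by ring
  rw [e]
  rcases le_total 0 u with hu | hu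
  · have h3 := lin h₁ (-u)
    have h4 := quad h₂ u hu
    have h5 := mul_le_mul_of_nonneg_right (min_le_right p₁ p₂) (sq_nonneg u)
    linarith
  · have h3 := quad h₁ (-u) (by linarith)
    have h4 := lin h₂ u
    have h5 := mul_le_mul_of_nonneg_right (min_le_left p₁ p₂) (sq_nonneg u)
    rw [neg_sq] at h3
    linarith

section Constants

variable {L₁ p₁ L₂ p₂ : ℝ} (hL₁ : 0 < L₁) (hp₁ : 0 < p₁) (hL₂ : 0 < L₂) (hp₂ : 0 < p₂)
include hL₁ hp₁ hL₂ hp₂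

theorem constA_pos : 0 < constA L₁ p₁ L₂ p₂ := by
  unfold constA; positivity

/-- This is the stationarity condition of the exponent in `log y` at `z_x`, after removal of the
common power of `x`. -/
theorem constA_balance :
    p₁ * L₁ * constA L₁ p₁ L₂ p₂ ^ (-p₁) = p₂ * L₂ * constA L₁ p₁ L₂ p₂ ^ p₂ := by
  have hA := constA_pos hL₁ hp₁ hL₂ hp₂
  have h : constA L₁ p₁ L₂ p₂ ^ (p₁ + p₂) = (p₁ * L₁) / (p₂ * L₂) := by
    unfold constA
    rw [← Real.rpow_mul (by positivity), one_div_mul_cancel (by positivity), Real.rpow_one]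
  rw [Real.rpow_add hA] at h
  rw [Real.rpow_neg hA.le]
  field_simp at h ⊢
  linarith

theorem constA_swap : constA L₂ p₂ L₁ p₁ = (constA L₁ p₁ L₂ p₂)⁻¹ := by
  unfold constA
  rw [← Real.inv_rpow (by positivity), inv_div, add_comm]

theorem zfun_pos {x : ℝ} (hx : 0 < x) : 0 < zfun L₁ p₁ L₂ p₂ x :=
  mul_pos (constA_pos hL₁ hp₁ hL₂ hp₂) (by positivity)

/-- The substitution `y ↦ x / y` exchanges the two factors and their saddle points. It carries every
fact about `z_x` over to `x / z_x`. -/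
theorem zfun_swap {x : ℝ} (hx : 0 < x) :
    zfun L₂ p₂ L₁ p₁ x = x / zfun L₁ p₁ L₂ p₂ x := by
  have hA := constA_pos hL₁ hp₁ hL₂ hp₂
  unfold zfun
  rw [constA_swap hL₁ hp₁ hL₂ hp₂, eq_div_iff (by positivity)]
  have h : x ^ (p₂ / (p₂ + p₁)) * x ^ (p₁ / (p₁ + p₂)) = x := by
    rw [← Real.rpow_add hx, add_comm p₂ p₁, ← add_div, add_comm p₂ p₁,
      div_self (by positivity), Real.rpow_one]
  calc _ = (constA L₁ p₁ L₂ p₂)⁻¹ * constA L₁ p₁ L₂ p₂ *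
        (x ^ (p₂ / (p₂ + p₁)) * x ^ (p₁ / (p₁ + p₂))) := by ring
    _ = x := by rw [h, inv_mul_cancel₀ hA.ne', one_mul]

theorem zfun_rpow {x : ℝ} (hx : 0 < x) :
    zfun L₁ p₁ L₂ p₂ x ^ p₂ = constA L₁ p₁ L₂ p₂ ^ p₂ * x ^ (p₁ * p₂ / (p₁ + p₂)) := by
  have hA := constA_pos hL₁ hp₁ hL₂ hp₂
  unfold zfun
  rw [Real.mul_rpow hA.le (by positivity), ← Real.rpow_mul hx.le]
  ring_nf

theorem div_zfun_rpow {x : ℝ} (hx : 0 < x) :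
    (x / zfun L₁ p₁ L₂ p₂ x) ^ p₁ =
      constA L₁ p₁ L₂ p₂ ^ (-p₁) * x ^ (p₁ * p₂ / (p₁ + p₂)) := by
  have hA := constA_pos hL₁ hp₁ hL₂ hp₂
  rw [← zfun_swap hL₁ hp₁ hL₂ hp₂ hx, zfun_rpow hL₂ hp₂ hL₁ hp₁ hx,
    constA_swap hL₁ hp₁ hL₂ hp₂, Real.inv_rpow hA.le, Real.rpow_neg hA.le, mul_comm p₂ p₁,
    add_comm p₂ p₁]

theorem tendsto_zfun : Tendsto (zfun L₁ p₁ L₂ p₂) atTop atTop :=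
  (tendsto_rpow_atTop (by positivity)).const_mul_atTop (constA_pos hL₁ hp₁ hL₂ hp₂)

theorem tendsto_div_zfun : Tendsto (fun x => x / zfun L₁ p₁ L₂ p₂ x) atTop atTop := by
  refine (tendsto_zfun hL₂ hp₂ hL₁ hp₁).congr' ?_
  filter_upwards [eventually_gt_atTop 0] with x hx using zfun_swap hL₁ hp₁ hL₂ hp₂ hx

theorem exponent_eq {x y : ℝ} (hx : 0 < x) (hy : 0 < y) :
    L₁ * (x / y) ^ p₁ + L₂ * y ^ p₂ = x ^ (p₁ * p₂ / (p₁ + p₂)) *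
      (p₁ * L₁ * constA L₁ p₁ L₂ p₂ ^ (-p₁)) *
      (Real.exp (-p₁ * Real.log (y / zfun L₁ p₁ L₂ p₂ x)) / p₁ +
        Real.exp (p₂ * Real.log (y / zfun L₁ p₁ L₂ p₂ x)) / p₂) := by
  have hz := zfun_pos hL₁ hp₁ hL₂ hp₂ hx
  have hb := constA_balance hL₁ hp₁ hL₂ hp₂
  have h1 : x / y = x / zfun L₁ p₁ L₂ p₂ x * (y / zfun L₁ p₁ L₂ p₂ x)⁻¹ := by field_simp
  have h2 : y = zfun L₁ p₁ L₂ p₂ x * (y / zfun L₁ p₁ L₂ p₂ x) := by field_simp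
  set w := y / zfun L₁ p₁ L₂ p₂ x
  have hw : 0 < w := by positivity
  have e1 : Real.exp (-p₁ * Real.log w) = w⁻¹ ^ p₁ := by
    rw [Real.rpow_def_of_pos (by positivity), Real.log_inv]; ring_nf
  have e2 : Real.exp (p₂ * Real.log w) = w ^ p₂ := by
    rw [Real.rpow_def_of_pos (by positivity), mul_comm]
  rw [e1, e2, h1, h2, Real.mul_rpow (by positivity) (by positivity),
    Real.mul_rpow hz.le hw.le, div_zfun_rpow hL₁ hp₁ hL₂ hp₂ hx, zfun_rpow hL₁ hp₁ hL₂ hp₂ hx,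
    mul_add]
  congr 1
  · field_simp
  · rw [hb]; field_simp

theorem constB_eq : constB L₁ p₁ L₂ p₂ =
    p₁ * L₁ * constA L₁ p₁ L₂ p₂ ^ (-p₁) * (1 / p₁ + 1 / p₂) := by
  have hb := constA_balance hL₁ hp₁ hL₂ hp₂
  unfold constB
  rw [mul_add]
  congr 1
  · field_simp
  · rw [hb]; field_simp

theorem constB_pos : 0 < constB L₁ p₁ L₂ p₂ := by
  have hA := constA_pos hL₁ hp₁ hL₂ hp₂
  unfold constB; positivity

/-- The exponent is minimal at `y = z_x`, with quadratic growth in `log (y / z_x)`. -/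
theorem exponent_ge {x y : ℝ} (hx : 0 < x) (hy : 0 < y) :
    x ^ (p₁ * p₂ / (p₁ + p₂)) * (constB L₁ p₁ L₂ p₂ + p₁ * L₁ * constA L₁ p₁ L₂ p₂ ^ (-p₁) *
      (min p₁ p₂ / 2 * Real.log (y / zfun L₁ p₁ L₂ p₂ x) ^ 2)) ≤
    L₁ * (x / y) ^ p₁ + L₂ * y ^ p₂ := by
  have hA := constA_pos hL₁ hp₁ hL₂ hp₂
  rw [exponent_eq hL₁ hp₁ hL₂ hp₂ hx hy, constB_eq hL₁ hp₁ hL₂ hp₂, ← mul_add, ← mul_assoc]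
  exact mul_le_mul_of_nonneg_left (exp_combination_ge hp₁ hp₂ _) (by positivity)

end Constants

/-! ### Weibull-type kernels and laws -/

theorem isEquivalent_of_eventually_le {f g : ℝ → ℝ} {l : Filter ℝ} (hg : ∀ᶠ x in l, 0 < g x)
    {a b : ℝ → ℝ} (ha : Tendsto a (𝓝[>] 0) (𝓝 1)) (hb : Tendsto b (𝓝[>] 0) (𝓝 1))
    (h : ∀ ε : ℝ, 0 < ε → ∀ᶠ x in l, a ε * g x ≤ f x ∧ f x ≤ b ε * g x) : f ~[l] g := by
  refine IsLittleO.of_bound fun c hc => ?_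
  have h1 := ha.eventually (Ioi_mem_nhds (show 1 - c < 1 by linarith))
  have h2 := hb.eventually (Iio_mem_nhds (show 1 < 1 + c by linarith))
  obtain ⟨ε, ⟨h1, h2⟩, hε⟩ := ((h1.and h2).and self_mem_nhdsWithin).exists
  filter_upwards [h ε hε, hg] with x hx hgx
  rw [Pi.sub_apply, Real.norm_eq_abs, Real.norm_eq_abs, abs_of_pos hgx, abs_le]
  constructor <;> nlinarith

theorem eventually_le_of_isEquivalent {f g : ℝ → ℝ} {l : Filter ℝ} (hg : ∀ᶠ x in l, 0 < g x)
    (h : f ~[l] g) {ε : ℝ} (hε : 0 < ε) :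
    ∀ᶠ x in l, Real.exp (-ε) * g x ≤ f x ∧ f x ≤ Real.exp ε * g x := by
  have ht := (isEquivalent_iff_tendsto_one (hg.mono fun x hx => hx.ne')).1 h
  have h1 : Real.exp (-ε) < 1 := by rw [Real.exp_lt_one_iff]; linarith
  have h2 : 1 < Real.exp ε := Real.one_lt_exp_iff.2 hε
  filter_upwards [ht.eventually (Ioo_mem_nhds h1 h2), hg] with x hx hgx
  rw [Pi.div_apply, lt_div_iff₀ hgx, div_lt_iff₀ hgx] at hx
  exact ⟨hx.1.le, hx.2.le⟩

/-- A nonnegative, locally bounded function with `k u ∼ G u * exp (-L u ^ p)`. -/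
structure WeibullKernel (k G : ℝ → ℝ) (L p : ℝ) : Prop where
  L_pos : 0 < L
  p_pos : 0 < p
  measurable : Measurable k
  nonneg : ∀ u, 0 < u → 0 ≤ k u
  irv : IntermediateRV G
  equiv : k ~[atTop] fun u => G u * Real.exp (-L * u ^ p)
  bdd : ∀ a : ℝ, ∃ M : ℝ, ∀ u, 0 < u → u ≤ a → k u ≤ M

theorem WeibullKernel.eventually_le {k G : ℝ → ℝ} {L p : ℝ} (h : WeibullKernel k G L p) {ε : ℝ}
    (hε : 0 < ε) : ∀ᶠ u in atTop, Real.exp (-ε) * (G u * Real.exp (-L * u ^ p)) ≤ k u ∧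
      k u ≤ Real.exp ε * (G u * Real.exp (-L * u ^ p)) :=
  eventually_le_of_isEquivalent (h.irv.pos.mono fun _ hx => mul_pos hx (Real.exp_pos _)) h.equiv hε

/-- Giving up the fraction `1 - θ` of the exponent absorbs `G` at infinity; on a bounded range `k`
is bounded. The constant is the sum of the two. -/
theorem WeibullKernel.exp_bound {k G : ℝ → ℝ} {L p : ℝ} (h : WeibullKernel k G L p) {θ : ℝ}
    (h0 : 0 < θ) (h1 : θ < 1) :
    ∃ C : ℝ, 0 ≤ C ∧ ∀ u, 0 < u → k u ≤ C * Real.exp (-θ * (L * u ^ p)) := by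
  have hL := h.L_pos
  obtain ⟨a, ha⟩ := eventually_atTop.1 ((h.eventually_le one_pos).and
    (h.irv.growth h.p_pos (show 0 < (1 - θ) * L from mul_pos (by linarith) hL)))
  obtain ⟨M, hM⟩ := h.bdd a
  refine ⟨Real.exp 1 + max M 0 * Real.exp (θ * (L * a ^ p)), by positivity, fun u hu => ?_⟩
  rw [add_mul]
  rcases le_total a u with hau | hau
  · obtain ⟨⟨-, h2⟩, -, h3⟩ := ha u hau
    refine (h2.trans ?_).trans (le_add_of_nonneg_right (by positivity))
    refine mul_le_mul_of_nonneg_left ?_ (by positivity)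
    refine (mul_le_mul_of_nonneg_right h3 (Real.exp_pos _).le).trans ?_
    rw [← Real.exp_add]
    exact Real.exp_le_exp.2 (by linarith)
  · refine ((hM u hu hau).trans ?_).trans (le_add_of_nonneg_left (by positivity))
    rw [mul_assoc, ← Real.exp_add]
    have : u ^ p ≤ a ^ p := Real.rpow_le_rpow hu.le hau h.p_pos.le
    have h4 : L * u ^ p ≤ L * a ^ p := mul_le_mul_of_nonneg_left this hL.le
    have h5 : 1 ≤ Real.exp (θ * (L * a ^ p) + -θ * (L * u ^ p)) := Real.one_le_exp (by nlinarith)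
    nlinarith [le_max_left M 0, le_max_right M 0]

/-- A law on `(0, ∞)` whose tail is `exp (-L u ^ p)` on the logarithmic scale. -/
structure WeibullLaw (ν : Measure ℝ) (L p : ℝ) : Prop where
  L_pos : 0 < L
  p_pos : 0 < p
  ae_pos : ∀ᵐ y ∂ν, 0 < y
  moment : ∀ θ : ℝ, 0 < θ → θ < 1 →
    IntegrableOn (fun y => Real.exp (θ * (L * y ^ p))) (Set.Ioi 0) ν
  lower : ∀ θ : ℝ, 1 < θ → ∀ᶠ y in atTop, Real.exp (-θ * (L * y ^ p)) ≤ ν.real (Set.Ioi y)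

/-- For the moments, the layer-cake formula meets a tail of order `t ^ (-θ'/θ)` with `θ < θ' < 1`,
which is integrable at infinity. -/
theorem WeibullKernel.weibullLaw {ν : Measure ℝ} [IsProbabilityMeasure ν] {G : ℝ → ℝ} {L p : ℝ}
    (h : WeibullKernel (fun u => ν.real (Set.Ioi u)) G L p) (hν : ∀ᵐ y ∂ν, 0 < y) :
    WeibullLaw ν L p := by
  have hL := h.L_pos
  have hp := h.p_pos
  refine ⟨hL, hp, hν, fun θ h0 h1 => ?_, fun θ hθ => ?_⟩
  · obtain ⟨θ', h2, h3⟩ := exists_between h1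
    obtain ⟨C, hC, hb⟩ := h.exp_bound (h0.trans h2) h3
    have hm : Measurable fun y : ℝ => Real.exp (θ * (L * y ^ p)) := by fun_prop
    refine Integrable.integrableOn ⟨hm.aestronglyMeasurable, ?_⟩
    rw [hasFiniteIntegral_iff_ofReal (ae_of_all _ fun y => (Real.exp_pos _).le),
      lintegral_eq_lintegral_meas_lt _ (ae_of_all _ fun y => (Real.exp_pos _).le) hm.aemeasurable,
      ← Set.Ioc_union_Ioi_eq_Ioi (zero_le_one (α := ℝ))]
    refine (lintegral_union_le _ _ _).trans_lt (ENNReal.add_lt_top.2 ⟨?_, ?_⟩)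
    · refine (setLIntegral_mono measurable_const (g := fun _ => 1)
        fun t _ => prob_le_one).trans_lt ?_
      simp
    · have hint : IntegrableOn (fun t : ℝ => C * t ^ (-(θ' / θ))) (Set.Ioi 1) :=
        (integrableOn_Ioi_rpow_of_lt (by
          rw [neg_lt_neg_iff, one_lt_div h0]; exact h2) one_pos).const_mul C
      refine lt_of_le_of_lt ?_ hint.lintegral_lt_top
      refine setLIntegral_mono (by fun_prop) fun t ht => ?_
      have ht1 : 1 < t := ht
      have hlt : 0 < Real.log t := Real.log_pos ht1
      set u := (Real.log t / (θ * L)) ^ (1 / p) with hu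
      have hu0 : 0 < u := by positivity
      have hup : u ^ p = Real.log t / (θ * L) := by
        rw [hu, ← Real.rpow_mul (by positivity), one_div_mul_cancel hp.ne', Real.rpow_one]
      have hsub : ν {y | t < Real.exp (θ * (L * y ^ p))} ≤ ν (Set.Ioi u) := by
        refine measure_mono_ae ?_
        filter_upwards [hν] with y hy hty
        have hty : t < Real.exp (θ * (L * y ^ p)) := hty
        rw [← Real.log_lt_iff_lt_exp (by linarith), ← mul_assoc, ← div_lt_iff₀' (by positivity),
          ← hup] at hty
        exact (Real.rpow_lt_rpow_iff hu0.le hy.le hp).1 hty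
      refine hsub.trans ?_
      rw [← ofReal_measureReal]
      refine ENNReal.ofReal_le_ofReal ((hb u hu0).trans (le_of_eq ?_))
      rw [hup, Real.rpow_def_of_pos (by linarith)]
      congr 2
      field_simp
  -- The surplus `(θ - 1) L u^p` is split in half: one half pays for `G`, the other for the factor
  -- `e⁻¹`.
  · filter_upwards [h.eventually_le one_pos, h.irv.growth hp
      (show 0 < (θ - 1) * L / 2 from by have : 0 < θ - 1 := by linarith
                                        positivity),
      (tendsto_rpow_atTop hp).eventually_ge_atTop (1 / ((θ - 1) * L / 2))] with u h1 h2 h3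
    refine le_trans ?_ h1.1
    refine le_trans ?_ (mul_le_mul_of_nonneg_left
      (mul_le_mul_of_nonneg_right h2.1 (Real.exp_pos _).le) (Real.exp_pos _).le)
    rw [← Real.exp_add, ← Real.exp_add]
    have h4 : 0 < (θ - 1) * L / 2 := by
      have : 0 < θ - 1 := by linarith
      positivity
    rw [div_le_iff₀ h4] at h3
    exact Real.exp_le_exp.2 (by nlinarith)

theorem integrableOn_kernel_div {k G : ℝ → ℝ} {L p : ℝ} (hk : WeibullKernel k G L p)
    (ν : Measure ℝ) [IsProbabilityMeasure ν] {x : ℝ} (hx : 0 < x) :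
    IntegrableOn (fun y => k (x / y)) (Set.Ioi 0) ν := by
  obtain ⟨C, hC, hb⟩ := hk.exp_bound (θ := 1 / 2) (by norm_num) (by norm_num)
  have hm := hk.measurable
  refine Measure.integrableOn_of_bounded (M := C) (measure_ne_top _ _)
    (hm.comp (measurable_const.div measurable_id)).aestronglyMeasurable ?_
  filter_upwards [ae_restrict_mem measurableSet_Ioi] with y hy
  have hy : 0 < y := hy
  have hxy : 0 < x / y := by positivity
  rw [Real.norm_eq_abs, abs_of_nonneg (hk.nonneg _ hxy)]
  refine (hb _ hxy).trans (mul_le_of_le_one_right hC (Real.exp_le_one_iff.2 ?_))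
  have := hk.L_pos
  have : 0 ≤ L * (x / y) ^ p := by positivity
  linarith

theorem weibullKernel_exp {L p : ℝ} (hL : 0 < L) (hp : 0 < p) :
    WeibullKernel (fun u => Real.exp (-L * u ^ p)) (fun _ => 1) L p where
  L_pos := hL
  p_pos := hp
  measurable := by fun_prop
  nonneg u _ := (Real.exp_pos _).le
  irv := ⟨Eventually.of_forall fun _ => one_pos, fun ε hε => ⟨1, one_pos, Eventually.of_forall
    fun x s _ => by
      rw [mul_one, mul_one]
      exact ⟨Real.exp_le_one_iff.2 (by linarith), Real.one_le_exp hε.le⟩⟩⟩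
  equiv := by simpa using IsEquivalent.refl
  bdd a := ⟨1, fun u hu _ => Real.exp_le_one_iff.2 (by
    have : 0 ≤ L * u ^ p := by positivity
    linarith)⟩

/-! ### Localisation at the saddle point -/

/-- Chernoff bound for the part of the mixture away from the saddle point `z_x`. -/
theorem setIntegral_far_le {k : ℝ → ℝ} {ν : Measure ℝ} {C θ L₁ p₁ L₂ p₂ : ℝ}
    (hL₁ : 0 < L₁) (hp₁ : 0 < p₁) (hC : 0 ≤ C) (h0 : 0 < θ) (h1 : θ < 1)
    (hk : ∀ u, 0 < u → k u ≤ C * Real.exp (-θ * (L₁ * u ^ p₁)))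
    (hν : WeibullLaw ν L₂ p₂) {x δ : ℝ} (hx : 0 < x) (hδ : 0 < δ)
    (hint : IntegrableOn (fun y => k (x / y)) (Set.Ioi 0) ν) :
    ∫ y in Set.Ioi 0 \ {y | |Real.log (y / zfun L₁ p₁ L₂ p₂ x)| ≤ δ}, k (x / y) ∂ν ≤
      C * Real.exp (-θ * (x ^ (p₁ * p₂ / (p₁ + p₂)) * (constB L₁ p₁ L₂ p₂ +
        p₁ * L₁ * constA L₁ p₁ L₂ p₂ ^ (-p₁) * (min p₁ p₂ / 2 * δ ^ 2)))) *
      ∫ y in Set.Ioi 0, Real.exp (θ * (L₂ * y ^ p₂)) ∂ν := by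
  have hm := hν.moment θ h0 h1
  have hT : MeasurableSet (Set.Ioi (0 : ℝ) \ {y | |Real.log (y / zfun L₁ p₁ L₂ p₂ x)| ≤ δ}) := by
    refine measurableSet_Ioi.diff (measurableSet_le ?_ measurable_const)
    fun_prop
  have hA := constA_pos hL₁ hp₁ hν.L_pos hν.p_pos
  rw [← integral_const_mul]
  refine (setIntegral_mono_on (hint.mono_set Set.sdiff_subset)
    (IntegrableOn.mono_set (hm.const_mul _) Set.sdiff_subset) hT fun y hy => ?_).trans
    (setIntegral_mono_set (hm.const_mul _) (ae_of_all _ fun y => by positivity)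
      Set.sdiff_subset.eventuallyLE)
  have hy0 : 0 < y := hy.1
  have hyδ : δ < |Real.log (y / zfun L₁ p₁ L₂ p₂ x)| := not_le.1 hy.2
  refine (hk _ (by positivity)).trans ?_
  -- The factor `exp (θ L₂ y^p₂)` of the moment completes `-θ L₁ (x/y)^p₁` to `-θ` times the full
  -- exponent, which is large off the window.
  rw [mul_assoc, ← Real.exp_add]
  refine mul_le_mul_of_nonneg_left (Real.exp_le_exp.2 ?_) hC
  have h2 := exponent_ge hL₁ hp₁ hν.L_pos hν.p_pos hx hy0
  have h3 : δ ^ 2 ≤ Real.log (y / zfun L₁ p₁ L₂ p₂ x) ^ 2 := by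
    rw [← sq_abs (Real.log _)]; exact pow_le_pow_left₀ hδ.le hyδ.le 2
  have h4 : 0 < min p₁ p₂ := lt_min hp₁ hν.p_pos
  have h5 : x ^ (p₁ * p₂ / (p₁ + p₂)) * (constB L₁ p₁ L₂ p₂ +
      p₁ * L₁ * constA L₁ p₁ L₂ p₂ ^ (-p₁) * (min p₁ p₂ / 2 * δ ^ 2)) ≤
      L₁ * (x / y) ^ p₁ + L₂ * y ^ p₂ := by
    refine le_trans ?_ h2
    gcongr
  nlinarith [mul_le_mul_of_nonneg_left h5 h0.le]

/-- On `y > z_x` the integrand is at least its value at `z_x`, and the mass of that half-line is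
bounded below by `WeibullLaw.lower`. -/
theorem exp_le_integral_exp {ν : Measure ℝ} [IsProbabilityMeasure ν] {L₁ p₁ L₂ p₂ : ℝ}
    (hL₁ : 0 < L₁) (hp₁ : 0 < p₁) (hν : WeibullLaw ν L₂ p₂) {θ : ℝ} (hθ : 1 < θ) :
    ∀ᶠ x in atTop, Real.exp (-θ * (x ^ (p₁ * p₂ / (p₁ + p₂)) * constB L₁ p₁ L₂ p₂)) ≤
      ∫ y in Set.Ioi 0, Real.exp (-L₁ * (x / y) ^ p₁) ∂ν := by
  have hL₂ := hν.L_pos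
  have hp₂ := hν.p_pos
  have hA := constA_pos hL₁ hp₁ hL₂ hp₂
  filter_upwards [(tendsto_zfun hL₁ hp₁ hL₂ hp₂).eventually (hν.lower θ hθ),
    eventually_gt_atTop 0] with x h1 hx
  have hz := zfun_pos hL₁ hp₁ hL₂ hp₂ hx
  have hint := integrableOn_kernel_div (weibullKernel_exp hL₁ hp₁) ν hx
  have hsub : Set.Ioi (zfun L₁ p₁ L₂ p₂ x) ⊆ Set.Ioi 0 := Set.Ioi_subset_Ioi hz.le
  calc _ ≤ ν.real (Set.Ioi (zfun L₁ p₁ L₂ p₂ x)) *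
        Real.exp (-L₁ * (x / zfun L₁ p₁ L₂ p₂ x) ^ p₁) := by
        refine le_trans ?_ (mul_le_mul_of_nonneg_right h1 (Real.exp_pos _).le)
        rw [← Real.exp_add, zfun_rpow hL₁ hp₁ hL₂ hp₂ hx, div_zfun_rpow hL₁ hp₁ hL₂ hp₂ hx]
        refine Real.exp_le_exp.2 ?_
        unfold constB
        have : 0 ≤ (θ - 1) * (L₁ * constA L₁ p₁ L₂ p₂ ^ (-p₁) *
          x ^ (p₁ * p₂ / (p₁ + p₂))) := mul_nonneg (by linarith) (by positivity)
        nlinarith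
    _ = ∫ y in Set.Ioi (zfun L₁ p₁ L₂ p₂ x),
        Real.exp (-L₁ * (x / zfun L₁ p₁ L₂ p₂ x) ^ p₁) ∂ν := by
        rw [setIntegral_const, smul_eq_mul]
    _ ≤ ∫ y in Set.Ioi (zfun L₁ p₁ L₂ p₂ x), Real.exp (-L₁ * (x / y) ^ p₁) ∂ν := by
        refine setIntegral_mono_on (integrableOn_const (measure_ne_top _ _)) (hint.mono_set hsub)
          measurableSet_Ioi fun y hy => Real.exp_le_exp.2 ?_
        have hy : zfun L₁ p₁ L₂ p₂ x < y := hy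
        have hy0 : 0 < y := hz.trans hy
        have : (x / y) ^ p₁ ≤ (x / zfun L₁ p₁ L₂ p₂ x) ^ p₁ := by gcongr
        nlinarith
    _ ≤ _ := setIntegral_mono_set hint (ae_of_all _ fun y => (Real.exp_pos _).le)
        hsub.eventuallyLE

/-- The part of a mixture away from `z_x` is negligible. -/
theorem setIntegral_far_negligible {k G G' : ℝ → ℝ} {ν : Measure ℝ} [IsProbabilityMeasure ν]
    {L₁ p₁ L₂ p₂ : ℝ} (hk : WeibullKernel k G L₁ p₁) (hG' : IntermediateRV G')
    (hν : WeibullLaw ν L₂ p₂) {δ ε : ℝ} (hδ : 0 < δ) (hε : 0 < ε) :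
    ∀ᶠ x in atTop,
      ∫ y in Set.Ioi 0 \ {y | |Real.log (y / zfun L₁ p₁ L₂ p₂ x)| ≤ δ}, k (x / y) ∂ν ≤
        ε * (G' (x / zfun L₁ p₁ L₂ p₂ x) *
          ∫ y in Set.Ioi 0, Real.exp (-L₁ * (x / y) ^ p₁) ∂ν) := by
  have hL₁ := hk.L_pos
  have hp₁ := hk.p_pos
  have hL₂ := hν.L_pos
  have hp₂ := hν.p_pos
  have hA := constA_pos hL₁ hp₁ hL₂ hp₂
  have hB := constB_pos hL₁ hp₁ hL₂ hp₂
  set B := constB L₁ p₁ L₂ p₂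
  set a := constA L₁ p₁ L₂ p₂ ^ (-p₁) with ha
  have ha0 : 0 < a := by positivity
  set η := p₁ * L₁ * a * (min p₁ p₂ / 2 * δ ^ 2) with hη
  have hη0 : 0 < η := by
    have := lt_min hp₁ hp₂
    positivity
  -- With `N` the power of `x` in the exponent, the far part is at most of order `exp
  -- (-(1-τ)(B+η)N)`, and the target is at least `ε exp (-τN - (1+τ)BN)`. The ratio has exponent
  -- `(-η + τ(2B+η+1))N`, and this `τ` makes it `-ηN/2`.
  set τ := η / (2 * (2 * B + η + 1)) with hτ
  have hτ0 : 0 < τ := by positivity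
  have hτ1 : τ * (2 * B + η + 1) = η / 2 := by rw [hτ]; field_simp
  have hτ2 : τ < 1 := by nlinarith
  obtain ⟨C, hC, hb⟩ := hk.exp_bound (θ := 1 - τ) (by linarith) (by linarith)
  set K := ∫ y in Set.Ioi 0, Real.exp ((1 - τ) * (L₂ * y ^ p₂)) ∂ν
  have hq : 0 < p₁ * p₂ / (p₁ + p₂) := by positivity
  have hlim : Tendsto (fun x : ℝ => C * K * Real.exp (-(η / 2 * x ^ (p₁ * p₂ / (p₁ + p₂)))))
      atTop (𝓝 (C * K * 0)) :=
    (Real.tendsto_exp_neg_atTop_nhds_zero.comp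
      ((tendsto_rpow_atTop hq).const_mul_atTop (by positivity))).const_mul _
  rw [mul_zero] at hlim
  filter_upwards [hlim.eventually (Iio_mem_nhds hε), eventually_gt_atTop 0,
    exp_le_integral_exp hL₁ hp₁ hν (θ := 1 + τ) (by linarith),
    (tendsto_div_zfun hL₁ hp₁ hL₂ hp₂).eventually
      (hG'.growth hp₁ (ε := τ / a) (by positivity))] with x h1 hx h2 h3
  have hfar := setIntegral_far_le hL₁ hp₁ hC (by linarith) (by linarith) hb hν hx hδ
    (integrableOn_kernel_div hk ν hx)
  refine hfar.trans ?_
  set N := x ^ (p₁ * p₂ / (p₁ + p₂))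
  rw [div_zfun_rpow hL₁ hp₁ hL₂ hp₂ hx] at h3
  have e1 : -(τ / a) * (a * N) = -(τ * N) := by field_simp
  rw [← ha, e1] at h3
  refine le_trans ?_ (mul_le_mul_of_nonneg_left (mul_le_mul h3.1 h2 (Real.exp_pos _).le
    ((Real.exp_pos _).le.trans h3.1)) hε.le)
  refine le_trans (le_of_eq ?_) (mul_le_mul_of_nonneg_right (Set.mem_Iio.1 h1).le (by positivity))
  rw [← Real.exp_add, mul_assoc (C * K), ← Real.exp_add, mul_right_comm]
  congr 2
  linear_combination N * hτ1

/-- In a mixture the regularly varying factor may be frozen at the saddle point. -/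
theorem mixture_isEquivalent {k G : ℝ → ℝ} {ν : Measure ℝ} [IsProbabilityMeasure ν]
    {L₁ p₁ L₂ p₂ : ℝ} (hk : WeibullKernel k G L₁ p₁) (hν : WeibullLaw ν L₂ p₂) :
    (fun x => ∫ y in Set.Ioi 0, k (x / y) ∂ν) ~[atTop] fun x =>
      G (x / zfun L₁ p₁ L₂ p₂ x) * ∫ y in Set.Ioi 0, Real.exp (-L₁ * (x / y) ^ p₁) ∂ν := by
  have hL₁ := hk.L_pos
  have hp₁ := hk.p_pos
  have hL₂ := hν.L_pos
  have hp₂ := hν.p_pos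
  have hw := tendsto_div_zfun hL₁ hp₁ hL₂ hp₂
  have hK := weibullKernel_exp hL₁ hp₁
  have hpos : ∀ᶠ x in atTop, 0 < G (x / zfun L₁ p₁ L₂ p₂ x) *
      ∫ y in Set.Ioi 0, Real.exp (-L₁ * (x / y) ^ p₁) ∂ν := by
    filter_upwards [hw.eventually hk.irv.pos,
      exp_le_integral_exp hL₁ hp₁ hν one_lt_two] with x h1 h2
    exact mul_pos h1 ((Real.exp_pos _).trans_le h2)
  -- One `ε` in `2 * ε` comes from the asymptotics of `k`, the other from the oscillation of `G`.
  -- The terms `- ε` and `+ ε` are the far parts of the pure mixture and of the given one.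
  refine isEquivalent_of_eventually_le hpos (a := fun ε => Real.exp (-(2 * ε)) * (1 - ε))
    (b := fun ε => Real.exp (2 * ε) + ε) ?_ ?_ fun ε hε => ?_
  · have : Continuous fun ε : ℝ => Real.exp (-(2 * ε)) * (1 - ε) := by fun_prop
    simpa using (this.tendsto 0).mono_left nhdsWithin_le_nhds
  · have : Continuous fun ε : ℝ => Real.exp (2 * ε) + ε := by fun_prop
    simpa using (this.tendsto 0).mono_left nhdsWithin_le_nhds
  obtain ⟨δ, hδ, hosc⟩ := hk.irv.osc ε hε
  obtain ⟨U, hU⟩ := eventually_atTop.1 (hk.eventually_le hε)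
  filter_upwards [hw.eventually hosc, hw.eventually hk.irv.pos,
    (hw.const_mul_atTop (Real.exp_pos (-δ))).eventually_ge_atTop U, eventually_gt_atTop 0,
    setIntegral_far_negligible hk hk.irv hν hδ hε,
    setIntegral_far_negligible hK hK.irv hν hδ hε] with x h1 h2 h3 hx h4 h5
  have hz := zfun_pos hL₁ hp₁ hL₂ hp₂ hx
  have hi1 := integrableOn_kernel_div hk ν hx
  have hi2 := integrableOn_kernel_div hK ν hx
  have hT : MeasurableSet {y | |Real.log (y / zfun L₁ p₁ L₂ p₂ x)| ≤ δ} := by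
    refine measurableSet_le ?_ measurable_const
    fun_prop
  have s1 := integral_inter_add_sdiff hT hi1
  have s2 := integral_inter_add_sdiff hT hi2
  set z := zfun L₁ p₁ L₂ p₂ x
  set T := {y | |Real.log (y / z)| ≤ δ}
  have hnear : ∀ y ∈ Set.Ioi 0 ∩ T,
      Real.exp (-(2 * ε)) * (G (x / z) * Real.exp (-L₁ * (x / y) ^ p₁)) ≤ k (x / y) ∧
      k (x / y) ≤ Real.exp (2 * ε) * (G (x / z) * Real.exp (-L₁ * (x / y) ^ p₁)) := by
    rintro y ⟨hy0, hy⟩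
    have hy0 : 0 < y := hy0
    have hy : |Real.log (y / z)| ≤ δ := hy
    have e1 : x / y = Real.exp (-Real.log (y / z)) * (x / z) := by
      rw [Real.exp_neg, Real.exp_log (by positivity)]; field_simp
    have hyU : U ≤ x / y := by
      rw [e1]
      refine h3.trans (mul_le_mul_of_nonneg_right (Real.exp_le_exp.2 ?_) (by positivity))
      linarith [(abs_le.1 hy).2]
    obtain ⟨a1, a2⟩ := hU _ hyU
    obtain ⟨b1, b2⟩ := h1 (-Real.log (y / z)) (by rwa [abs_neg])
    rw [← e1] at b1 b2
    have hE := Real.exp_pos (-L₁ * (x / y) ^ p₁)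
    constructor
    · refine le_trans (le_of_eq ?_) ((mul_le_mul_of_nonneg_left (mul_le_mul_of_nonneg_right b1
        hE.le) (Real.exp_pos _).le).trans a1)
      rw [show -(2 * ε) = -ε + -ε by ring, Real.exp_add]; ring
    · refine (a2.trans (mul_le_mul_of_nonneg_left (mul_le_mul_of_nonneg_right b2
        hE.le) (Real.exp_pos _).le)).trans (le_of_eq ?_)
      rw [show 2 * ε = ε + ε by ring, Real.exp_add]; ring
  have hS : MeasurableSet (Set.Ioi 0 ∩ T) := measurableSet_Ioi.inter hT
  have n1 := hi1.mono_set (Set.inter_subset_left (t := T))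
  have n2 := hi2.mono_set (Set.inter_subset_left (t := T))
  have l1 := setIntegral_mono_on ((n2.const_mul (G (x / z))).const_mul _) n1 hS
    fun y hy => (hnear y hy).1
  have l2 := setIntegral_mono_on n1 ((n2.const_mul (G (x / z))).const_mul _) hS
    fun y hy => (hnear y hy).2
  rw [integral_const_mul, integral_const_mul] at l1 l2
  have f1 : 0 ≤ ∫ y in Set.Ioi 0 \ T, k (x / y) ∂ν :=
    setIntegral_nonneg (measurableSet_Ioi.diff hT) fun y hy =>
      hk.nonneg _ (div_pos hx (Set.mem_Ioi.1 hy.1))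
  have f2 : 0 ≤ ∫ y in Set.Ioi 0 \ T, Real.exp (-L₁ * (x / y) ^ p₁) ∂ν :=
    integral_nonneg fun y => (Real.exp_pos _).le
  rw [← s1]
  constructor
  · refine le_trans ?_ (l1.trans (le_add_of_nonneg_right f1))
    rw [mul_assoc]
    refine mul_le_mul_of_nonneg_left ?_ (Real.exp_pos _).le
    nlinarith
  · rw [add_mul]
    refine add_le_add (l2.trans ?_) h4
    refine mul_le_mul_of_nonneg_left (mul_le_mul_of_nonneg_left ?_ h2.le) (Real.exp_pos _).le
    linarith

/-! ### Laplace's method for two pure Weibull variables -/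

/-- Second-order Taylor expansion: at the scale `t / √M` the factor `M` keeps the quadratic term and
kills the rest. -/
theorem tendsto_mul_exp_remainder {p : ℝ} (hp : 0 < p) (t : ℝ) :
    Tendsto (fun M : ℝ => M * ((Real.exp (p * (t / √M)) - 1) / p - t / √M)) atTop
      (𝓝 (p / 2 * t ^ 2)) := by
  have hx : Tendsto (fun M : ℝ => p * (t / √M)) atTop (𝓝 0) := by
    simpa using (tendsto_const_nhds.div_atTop Real.tendsto_sqrt_atTop).const_mul p
  have ho := ((Real.exp_sub_sum_range_succ_isLittleO_pow 2).comp_tendsto hx)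
  have hM : (fun M : ℝ => M * (Real.exp (p * (t / √M)) -
      ∑ i ∈ Finset.range 3, (p * (t / √M)) ^ i / (i.factorial : ℝ))) =o[atTop]
      fun _ : ℝ => p ^ 2 * t ^ 2 := by
    refine ((isBigO_refl (fun M : ℝ => M) atTop).mul_isLittleO ho).congr' (by rfl) ?_
    filter_upwards [eventually_gt_atTop 0] with M hM
    simp only [Function.comp]
    rw [mul_pow, div_pow, Real.sq_sqrt hM.le]
    field_simp
  have hz : Tendsto (fun M : ℝ => M * (Real.exp (p * (t / √M)) -
      ∑ i ∈ Finset.range 3, (p * (t / √M)) ^ i / (i.factorial : ℝ))) atTop (𝓝 0) :=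
    (isLittleO_one_iff ℝ).1 (hM.trans_isBigO (isBigO_const_const _ one_ne_zero _))
  have := (hz.const_mul (1 / p)).add (tendsto_const_nhds (x := p / 2 * t ^ 2))
  rw [mul_zero, zero_add] at this
  refine this.congr' ?_
  filter_upwards [eventually_gt_atTop 0] with M hM
  have h2 : √M ^ 2 = M := Real.sq_sqrt hM.le
  have h3 : (p * (t / √M)) ^ 2 * M = p ^ 2 * t ^ 2 := by
    rw [mul_pow, div_pow, h2]; field_simp
  set v := t / √M
  simp only [Finset.sum_range_succ, Finset.sum_range_zero, Nat.factorial]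
  clear_value v
  have h4 : M * v ^ 2 = t ^ 2 := by
    have : p ≠ 0 := hp.ne'
    field_simp at h3
    linear_combination h3
  rw [← h4]
  field_simp
  push_cast
  ring

/-- Laplace's method for the exponent of the product of two Weibull variables. -/
theorem tendsto_laplace_integral {p₁ p₂ : ℝ} (h₁ : 0 < p₁) (h₂ : 0 < p₂) :
    Tendsto (fun M : ℝ => ∫ t : ℝ, Real.exp (p₂ * (t / √M)) *
      Real.exp (-(M * (Real.exp (-p₁ * (t / √M)) / p₁ + Real.exp (p₂ * (t / √M)) / p₂ -
        (1 / p₁ + 1 / p₂)))))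
      atTop (𝓝 √(2 * Real.pi / (p₁ + p₂))) := by
  set m := min p₁ p₂
  have hm : 0 < m := lt_min h₁ h₂
  have hg : √(2 * Real.pi / (p₁ + p₂)) = ∫ t : ℝ, Real.exp (-((p₁ + p₂) / 2) * t ^ 2) := by
    rw [integral_gaussian]; congr 1; field_simp
  rw [hg]
  refine tendsto_integral_filter_of_dominated_convergence
    (fun t => Real.exp (p₂ ^ 2 / m) * Real.exp (-(m / 4) * t ^ 2))
    (Eventually.of_forall fun M => by fun_prop) ?_
    ((integrable_exp_neg_mul_sq (by positivity)).const_mul _) (ae_of_all _ fun t => ?_)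
  · filter_upwards [eventually_ge_atTop 1] with M hM
    refine ae_of_all _ fun t => ?_
    have hM0 : 0 < M := by linarith
    have hs : 1 ≤ √M := Real.one_le_sqrt.2 hM
    rw [Real.norm_of_nonneg (by positivity), ← Real.exp_add, ← Real.exp_add]
    refine Real.exp_le_exp.2 ?_
    have e1 := mul_le_mul_of_nonneg_left (exp_combination_ge h₁ h₂ (t / √M)) hM0.le
    have e2 : M * (t / √M) ^ 2 = t ^ 2 := by
      rw [div_pow, Real.sq_sqrt hM0.le]; field_simp
    have e3 : t / √M ≤ |t| := by
      rw [div_le_iff₀ (by linarith)]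
      exact (le_abs_self t).trans (le_mul_of_one_le_right (abs_nonneg t) hs)
    -- Completing the square spends half of the quadratic decay `m / 2 * t ^ 2` on the linear
    -- factor; the other half gives the Gaussian majorant.
    have e4 : p₂ * |t| ≤ p₂ ^ 2 / m + m / 4 * t ^ 2 := by
      rw [← sq_abs t, ← sub_nonneg]
      have : p₂ ^ 2 / m + m / 4 * |t| ^ 2 - p₂ * |t| = (p₂ - m / 2 * |t|) ^ 2 / m := by
        field_simp; ring
      rw [this]; positivity
    have e5 := mul_le_mul_of_nonneg_left e3 h₂.le
    have e6 : M * (1 / p₁ + 1 / p₂ + m / 2 * (t / √M) ^ 2) =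
        M * (1 / p₁ + 1 / p₂) + m / 2 * t ^ 2 := by rw [← e2]; ring
    rw [e6] at e1
    linarith
  -- The linear terms of the two expansions, at `-t` and at `t`, cancel in the sum.
  · have q1 := tendsto_mul_exp_remainder h₁ (-t)
    have q2 := tendsto_mul_exp_remainder h₂ t
    have hx : Tendsto (fun M : ℝ => p₂ * (t / √M)) atTop (𝓝 0) := by
      simpa using (tendsto_const_nhds.div_atTop Real.tendsto_sqrt_atTop).const_mul p₂
    have h := ((Real.continuous_exp.tendsto _).comp hx).mul
      ((Real.continuous_exp.tendsto _).comp (q1.add q2).neg)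
    convert h using 2
    · simp only [Function.comp]
      congr 2
      rw [neg_div, mul_neg, neg_mul]
      ring
    · rw [Real.exp_zero, one_mul]; congr 1; ring

/-- The Weibull law with tail `exp (-L u ^ p)`, as the image of the exponential law. -/
noncomputable def weibullMeasure (L p : ℝ) : Measure ℝ :=
  ((volume.restrict (Set.Ioi 0)).withDensity fun e => ENNReal.ofReal (Real.exp (-e))).map
    fun e => (e / L) ^ (1 / p)

theorem withDensity_exp_Ioi {a : ℝ} (ha : 0 ≤ a) :
    ((volume.restrict (Set.Ioi 0)).withDensity fun e => ENNReal.ofReal (Real.exp (-e)))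
      (Set.Ioi a) = ENNReal.ofReal (Real.exp (-a)) := by
  rw [withDensity_apply _ measurableSet_Ioi, Measure.restrict_restrict measurableSet_Ioi,
    Set.inter_eq_left.2 (Set.Ioi_subset_Ioi ha), ← integral_exp_neg_Ioi,
    ofReal_integral_eq_lintegral_ofReal (by
      have := exp_neg_integrableOn_Ioi a one_pos
      simp only [neg_one_mul] at this
      exact this) (ae_of_all _ fun x => (Real.exp_pos _).le)]

theorem ae_pos_withDensity_exp : ∀ᵐ e ∂((volume.restrict (Set.Ioi 0)).withDensity
    fun e : ℝ => ENNReal.ofReal (Real.exp (-e))), 0 < e :=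
  (withDensity_absolutelyContinuous _ _).ae_le (ae_restrict_mem measurableSet_Ioi)

instance (L p : ℝ) : IsProbabilityMeasure (weibullMeasure L p) := by
  have : IsProbabilityMeasure ((volume.restrict (Set.Ioi 0)).withDensity
      fun e : ℝ => ENNReal.ofReal (Real.exp (-e))) := by
    refine ⟨?_⟩
    have h := withDensity_exp_Ioi le_rfl
    rw [neg_zero, Real.exp_zero, ENNReal.ofReal_one] at h
    rw [← h]
    exact (measure_eq_measure_of_null_sdiff (Set.subset_univ _) (by
      rw [← Set.compl_eq_univ_sdiff]; exact ae_pos_withDensity_exp)).symm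
  exact Measure.isProbabilityMeasure_map (by fun_prop)

section WeibullMeasure

variable {L p : ℝ}

theorem ae_pos_weibullMeasure (hL : 0 < L) : ∀ᵐ y ∂weibullMeasure L p, 0 < y := by
  rw [weibullMeasure, ae_map_iff (by fun_prop) measurableSet_Ioi]
  filter_upwards [ae_pos_withDensity_exp] with e he
  positivity

theorem weibullMeasure_real_Ioi (hL : 0 < L) (hp : 0 < p) {u : ℝ} (hu : 0 ≤ u) :
    (weibullMeasure L p).real (Set.Ioi u) = Real.exp (-L * u ^ p) := by
  have h : weibullMeasure L p (Set.Ioi u) = ENNReal.ofReal (Real.exp (-(L * u ^ p))) := by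
    rw [weibullMeasure, Measure.map_apply (by fun_prop) measurableSet_Ioi,
      ← withDensity_exp_Ioi (by positivity)]
    refine measure_congr ?_
    filter_upwards [ae_pos_withDensity_exp] with e he
    refine propext ?_
    change u < (e / L) ^ (1 / p) ↔ L * u ^ p < e
    rw [← Real.rpow_lt_rpow_iff hu (by positivity) hp, ← Real.rpow_mul (by positivity),
      one_div_mul_cancel hp.ne', Real.rpow_one, lt_div_iff₀' hL]
  rw [measureReal_def, h, ENNReal.toReal_ofReal (Real.exp_pos _).le, neg_mul]

theorem integral_weibullMeasure (hL : 0 < L) {φ : ℝ → ℝ} (hφ : Measurable φ) :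
    ∫ y in Set.Ioi 0, φ y ∂weibullMeasure L p =
      ∫ e in Set.Ioi 0, Real.exp (-e) * φ ((e / L) ^ (1 / p)) := by
  rw [Measure.restrict_eq_self_of_ae_mem (s := Set.Ioi 0) (ae_pos_weibullMeasure hL),
    weibullMeasure,
    integral_map (by fun_prop) hφ.aestronglyMeasurable,
    integral_withDensity_eq_integral_toReal_smul (by fun_prop) (by simp)]
  simp [ENNReal.toReal_ofReal (Real.exp_pos _).le]

theorem weibullLaw_weibullMeasure (hL : 0 < L) (hp : 0 < p) :
    WeibullLaw (weibullMeasure L p) L p := by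
  refine WeibullKernel.weibullLaw (G := fun _ => 1) ⟨hL, hp, ?_, fun u _ => measureReal_nonneg,
    (weibullKernel_exp hL hp).irv, ?_, fun a => ⟨1, fun u _ _ => measureReal_le_one⟩⟩
    (ae_pos_weibullMeasure hL)
  · exact Antitone.measurable fun a b hab =>
      measureReal_mono (Set.Ioi_subset_Ioi hab) (measure_ne_top _ _)
  · refine EventuallyEq.isEquivalent ?_
    filter_upwards [eventually_ge_atTop 0] with u hu
    rw [weibullMeasure_real_Ioi hL hp hu, one_mul]

end WeibullMeasure

section WeibullProductIntegral

variable {L₁ p₁ L₂ p₂ : ℝ} (hL₁ : 0 < L₁) (hp₁ : 0 < p₁) (hL₂ : 0 < L₂) (hp₂ : 0 < p₂)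
include hL₁ hp₁ hL₂ hp₂

/-- The substitution is `y = z_x exp (t / √M)`. In the exponential variable it reads `e = (M / p₂)
exp (p₂ t / √M)`, since `constA_balance` makes `L₂ z_x^p₂` equal to `M / p₂`; the Jacobian supplies
`√M` and the first exponential. -/
theorem integral_weibull_product {x : ℝ} (hx : 0 < x) {M : ℝ}
    (hM : M = p₁ * L₁ * constA L₁ p₁ L₂ p₂ ^ (-p₁) * x ^ (p₁ * p₂ / (p₁ + p₂))) :
    ∫ y in Set.Ioi 0, Real.exp (-L₁ * (x / y) ^ p₁) ∂weibullMeasure L₂ p₂ =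
      √M * Real.exp (-(M * (1 / p₁ + 1 / p₂))) * ∫ t : ℝ, Real.exp (p₂ * (t / √M)) *
        Real.exp (-(M * (Real.exp (-p₁ * (t / √M)) / p₁ + Real.exp (p₂ * (t / √M)) / p₂ -
          (1 / p₁ + 1 / p₂)))) := by
  have hA := constA_pos hL₁ hp₁ hL₂ hp₂
  have hz := zfun_pos hL₁ hp₁ hL₂ hp₂ hx
  have hM0 : 0 < M := by rw [hM]; positivity
  have hs : 0 < √M := Real.sqrt_pos.2 hM0
  set f : ℝ → ℝ := fun t => M / p₂ * Real.exp (p₂ * (t / √M)) with hf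
  have himg : f '' Set.univ = Set.Ioi 0 := by
    ext e
    simp only [Set.image_univ, Set.mem_range, Set.mem_Ioi, hf]
    refine ⟨fun ⟨t, ht⟩ => ht ▸ by positivity, fun he =>
      ⟨√M / p₂ * Real.log (p₂ / M * e), ?_⟩⟩
    have : p₂ * (√M / p₂ * Real.log (p₂ / M * e) / √M) = Real.log (p₂ / M * e) := by field_simp
    rw [this, Real.exp_log (by positivity)]
    field_simp
  have hder : ∀ t ∈ Set.univ, HasDerivWithinAt f (√M * Real.exp (p₂ * (t / √M))) Set.univ t := by
    intro t _
    have h := ((((hasDerivAt_id t).div_const (√M)).const_mul p₂).exp.const_mul (M / p₂))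
    have e : M / p₂ * (Real.exp (p₂ * (t / √M)) * (p₂ * (1 / √M))) =
        √M * Real.exp (p₂ * (t / √M)) := by
      nth_rewrite 1 [← Real.mul_self_sqrt hM0.le]
      field_simp
    rw [← e]
    exact h.hasDerivWithinAt
  have hinj : Set.InjOn f Set.univ := by
    intro a _ b _ hab
    have h1 := mul_left_cancel₀ (by positivity) hab
    have h2 := mul_left_cancel₀ hp₂.ne' (Real.exp_injective h1)
    exact (div_left_inj' hs.ne').1 h2
  rw [integral_weibullMeasure hL₂ (by fun_prop), ← himg,
    integral_image_eq_integral_abs_deriv_smul MeasurableSet.univ hder hinj, setIntegral_univ,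
    ← integral_const_mul]
  refine integral_congr_ae (ae_of_all _ fun t => ?_)
  simp only [smul_eq_mul]
  set u := t / √M
  have hzM : M / p₂ = L₂ * zfun L₁ p₁ L₂ p₂ x ^ p₂ := by
    rw [zfun_rpow hL₁ hp₁ hL₂ hp₂ hx, hM, constA_balance hL₁ hp₁ hL₂ hp₂]
    field_simp
  have hy : (f t / L₂) ^ (1 / p₂) = zfun L₁ p₁ L₂ p₂ x * Real.exp u := by
    have : f t / L₂ = (zfun L₁ p₁ L₂ p₂ x * Real.exp u) ^ p₂ := by
      rw [Real.mul_rpow hz.le (Real.exp_pos _).le, ← Real.exp_mul, hf]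
      simp only []
      rw [hzM, mul_comm u, mul_assoc, mul_div_cancel_left₀ _ hL₂.ne']
    rw [this, ← Real.rpow_mul (by positivity), mul_one_div_cancel hp₂.ne', Real.rpow_one]
  have hft : f t = L₂ * (zfun L₁ p₁ L₂ p₂ x * Real.exp u) ^ p₂ := by
    rw [← hy, ← Real.rpow_mul (by positivity), one_div_mul_cancel hp₂.ne', Real.rpow_one]
    field_simp
  have hE := exponent_eq hL₁ hp₁ hL₂ hp₂ hx (y := zfun L₁ p₁ L₂ p₂ x * Real.exp u)
    (by positivity)
  rw [mul_div_cancel_left₀ _ hz.ne', Real.log_exp, mul_comm (x ^ _), ← hM, ← hft] at hE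
  rw [hy, abs_of_pos (by positivity), ← Real.exp_add]
  rw [mul_assoc, mul_assoc, ← Real.exp_add, ← Real.exp_add, ← Real.exp_add]
  congr 2
  linear_combination -hE

theorem weibull_product_isEquivalent :
    (fun x => ∫ y in Set.Ioi 0, Real.exp (-L₁ * (x / y) ^ p₁) ∂weibullMeasure L₂ p₂) ~[atTop]
      fun x => (2 * Real.pi * p₂ * L₂ / (p₁ + p₂)) ^ (1 / 2 : ℝ) *
        constA L₁ p₁ L₂ p₂ ^ (p₂ / 2) * x ^ (p₁ * p₂ / (2 * (p₁ + p₂))) *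
        Real.exp (-constB L₁ p₁ L₂ p₂ * x ^ (p₁ * p₂ / (p₁ + p₂))) := by
  have hA := constA_pos hL₁ hp₁ hL₂ hp₂
  set c := p₁ * L₁ * constA L₁ p₁ L₂ p₂ ^ (-p₁) with hc
  have hc0 : 0 < c := by positivity
  have hq : 0 < p₁ * p₂ / (p₁ + p₂) := by positivity
  have hM : Tendsto (fun x : ℝ => c * x ^ (p₁ * p₂ / (p₁ + p₂))) atTop atTop :=
    (tendsto_rpow_atTop hq).const_mul_atTop hc0
  have hlim := (tendsto_laplace_integral hp₁ hp₂).comp hM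
  have hne : √(2 * Real.pi / (p₁ + p₂)) ≠ 0 := by positivity
  have heq := (isEquivalent_const_iff_tendsto hne).2 hlim
  have h := (IsEquivalent.refl (l := atTop) (u := fun x : ℝ =>
    √(c * x ^ (p₁ * p₂ / (p₁ + p₂))) *
      Real.exp (-(c * x ^ (p₁ * p₂ / (p₁ + p₂)) * (1 / p₁ + 1 / p₂))))).mul heq
  refine (h.congr_left ?_).congr_right ?_
  · filter_upwards [eventually_gt_atTop 0] with x hx
    exact (integral_weibull_product hL₁ hp₁ hL₂ hp₂ hx rfl).symm
  · filter_upwards [eventually_gt_atTop 0] with x hx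
    have e1 : constB L₁ p₁ L₂ p₂ = c * (1 / p₁ + 1 / p₂) := constB_eq hL₁ hp₁ hL₂ hp₂
    have e2 : c = p₂ * L₂ * constA L₁ p₁ L₂ p₂ ^ p₂ := constA_balance hL₁ hp₁ hL₂ hp₂
    have e3 : constA L₁ p₁ L₂ p₂ ^ (p₂ / 2) = √(constA L₁ p₁ L₂ p₂ ^ p₂) := by
      rw [Real.sqrt_eq_rpow, ← Real.rpow_mul hA.le]; ring_nf
    have e4 : x ^ (p₁ * p₂ / (2 * (p₁ + p₂))) = √(x ^ (p₁ * p₂ / (p₁ + p₂))) := by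
      rw [Real.sqrt_eq_rpow, ← Real.rpow_mul hx.le]; congr 1; field_simp
    have e5 : -constB L₁ p₁ L₂ p₂ * x ^ (p₁ * p₂ / (p₁ + p₂)) =
        -(c * x ^ (p₁ * p₂ / (p₁ + p₂)) * (1 / p₁ + 1 / p₂)) := by rw [e1]; ring
    rw [e3, e4, e5, ← Real.sqrt_eq_rpow, ← Real.sqrt_mul (by positivity),
      ← Real.sqrt_mul (by positivity), Pi.mul_apply, mul_right_comm,
      Function.const_apply, ← Real.sqrt_mul (by positivity)]
    congr 2
    rw [e2]; field_simp

end WeibullProductIntegral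

/-! ### Product tails as mixtures -/

theorem tail_eq_map {Ω : Type*} [MeasurableSpace Ω] {P : Measure Ω} {X : Ω → ℝ}
    (hX : Measurable X) (x : ℝ) : tail P X x = (P.map X).real (Set.Ioi x) := by
  rw [map_measureReal_apply hX measurableSet_Ioi]; rfl

section Mixture

variable {μ₁ μ₂ : Measure ℝ} [IsProbabilityMeasure μ₁] [IsProbabilityMeasure μ₂]

theorem prod_real_mul_gt (h₂ : ∀ᵐ y ∂μ₂, 0 < y) (x : ℝ) :
    (μ₁.prod μ₂).real {z | x < z.1 * z.2} =
      ∫ y in Set.Ioi 0, μ₁.real (Set.Ioi (x / y)) ∂μ₂ := by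
  have hs : MeasurableSet {z : ℝ × ℝ | x < z.1 * z.2} :=
    measurableSet_lt measurable_const (by fun_prop)
  rw [Measure.restrict_eq_self_of_ae_mem (s := Set.Ioi 0) h₂, measureReal_def,
    Measure.prod_apply_symm hs, ← integral_toReal (measurable_measure_prodMk_right hs).aemeasurable
      (ae_of_all _ fun y => measure_lt_top _ _)]
  refine integral_congr_ae ?_
  filter_upwards [h₂] with y hy
  rw [measureReal_def]
  congr 2
  ext a
  simp [div_lt_iff₀ hy]

/-- Both sides are the probability that the product of independent variables exceeds `x`,
conditioned on one factor or the other. -/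
theorem mixture_tail_comm (h₁ : ∀ᵐ y ∂μ₁, 0 < y) (h₂ : ∀ᵐ y ∂μ₂, 0 < y) (x : ℝ) :
    ∫ y in Set.Ioi 0, μ₁.real (Set.Ioi (x / y)) ∂μ₂ =
      ∫ y in Set.Ioi 0, μ₂.real (Set.Ioi (x / y)) ∂μ₁ := by
  rw [← prod_real_mul_gt h₂, ← prod_real_mul_gt h₁, ← Measure.prod_swap,
    map_measureReal_apply measurable_swap (measurableSet_lt measurable_const (by fun_prop))]
  simp [mul_comm]

end Mixture

variable {Ω : Type*} [MeasurableSpace Ω] {P : Measure Ω}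

theorem IsWeibullType.weibullKernel [IsProbabilityMeasure P] {X : Ω → ℝ} {g : ℝ → ℝ} {α L p : ℝ}
    (h : IsWeibullType P X g α L p) (hg : UltimatelyMonotone g) :
    WeibullKernel (fun u => (P.map X).real (Set.Ioi u)) g L p := by
  have := Measure.isProbabilityMeasure_map (μ := P) h.measurable.aemeasurable
  refine ⟨h.L_pos, h.p_pos, Antitone.measurable fun a b hab =>
    measureReal_mono (Set.Ioi_subset_Ioi hab) (measure_ne_top _ _), fun u _ => measureReal_nonneg,
    h.regularlyVarying.intermediateRV hg, ?_, fun a => ⟨1, fun u _ _ => measureReal_le_one⟩⟩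
  exact h.tail_equiv.congr_left (Eventually.of_forall fun u => tail_eq_map h.measurable u)

theorem IsWeibullType.ae_pos_map {X : Ω → ℝ} {g : ℝ → ℝ} {α L p : ℝ}
    (h : IsWeibullType P X g α L p) : ∀ᵐ y ∂P.map X, 0 < y :=
  (ae_map_iff h.measurable.aemeasurable measurableSet_Ioi).2 h.pos

theorem map_mul_eq [IsProbabilityMeasure P] {X₁ X₂ : Ω → ℝ} (h₁ : Measurable X₁)
    (h₂ : Measurable X₂) (hindep : IndepFun X₁ X₂ P) : P.map (fun ω => X₁ ω * X₂ ω) =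
      ((P.map X₁).prod (P.map X₂)).map fun z => z.1 * z.2 := by
  rw [← (indepFun_iff_map_prod_eq_prod_map_map h₁.aemeasurable h₂.aemeasurable).1 hindep,
    Measure.map_map (by fun_prop) (h₁.prodMk h₂)]
  rfl

theorem tail_mul_eq [IsProbabilityMeasure P] {X₁ X₂ : Ω → ℝ} (h₁ : Measurable X₁)
    (h₂ : Measurable X₂) (hindep : IndepFun X₁ X₂ P) (hpos : ∀ᵐ y ∂P.map X₂, 0 < y) (x : ℝ) :
    tail P (fun ω => X₁ ω * X₂ ω) x =
      ∫ y in Set.Ioi 0, (P.map X₁).real (Set.Ioi (x / y)) ∂P.map X₂ := by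
  have := Measure.isProbabilityMeasure_map (μ := P) h₁.aemeasurable
  have := Measure.isProbabilityMeasure_map (μ := P) h₂.aemeasurable
  rw [tail_eq_map (X := fun ω => X₁ ω * X₂ ω) (h₁.mul h₂), map_mul_eq h₁ h₂ hindep,
    map_measureReal_apply (by fun_prop) measurableSet_Ioi, ← prod_real_mul_gt hpos]
  rfl

/-- A mixture of Weibull tails over a Weibull-type law. -/
theorem weibull_mixture_isEquivalent {ν : Measure ℝ} [IsProbabilityMeasure ν] {G : ℝ → ℝ}
    {L₁ p₁ L₂ p₂ : ℝ} (hL₁ : 0 < L₁) (hp₁ : 0 < p₁)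
    (hk : WeibullKernel (fun u => ν.real (Set.Ioi u)) G L₂ p₂) (hν : ∀ᵐ y ∂ν, 0 < y) :
    (fun x => ∫ y in Set.Ioi 0, Real.exp (-L₁ * (x / y) ^ p₁) ∂ν) ~[atTop] fun x =>
      G (zfun L₁ p₁ L₂ p₂ x) * ((2 * Real.pi * p₂ * L₂ / (p₁ + p₂)) ^ (1 / 2 : ℝ) *
        constA L₁ p₁ L₂ p₂ ^ (p₂ / 2) * x ^ (p₁ * p₂ / (2 * (p₁ + p₂))) *
        Real.exp (-constB L₁ p₁ L₂ p₂ * x ^ (p₁ * p₂ / (p₁ + p₂)))) := by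
  have hL₂ := hk.L_pos
  have hp₂ := hk.p_pos
  have comm : ∀ (ν' : Measure ℝ) [IsProbabilityMeasure ν'], (∀ᵐ y ∂ν', 0 < y) → ∀ x : ℝ, 0 < x →
      ∫ y in Set.Ioi 0, Real.exp (-L₁ * (x / y) ^ p₁) ∂ν' =
        ∫ y in Set.Ioi 0, ν'.real (Set.Ioi (x / y)) ∂weibullMeasure L₁ p₁ := by
    intro ν' _ hν' x hx
    rw [← mixture_tail_comm (ae_pos_weibullMeasure hL₁) hν']
    refine setIntegral_congr_fun measurableSet_Ioi fun y hy => ?_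
    exact (weibullMeasure_real_Ioi hL₁ hp₁ (div_pos hx hy).le).symm
  -- Freezing with the roles exchanged: the kernel is now the tail of `ν` and the mixing law is pure
  -- Weibull. Applying `comm` to `ν` and then to the pure law returns to the original order.
  have h1 := mixture_isEquivalent hk (weibullLaw_weibullMeasure hL₁ hp₁)
  have h2 := weibull_product_isEquivalent hL₁ hp₁ hL₂ hp₂
  refine IsEquivalent.trans (h1.congr_left ?_) (((IsEquivalent.refl (l := atTop)
    (u := fun x => G (zfun L₁ p₁ L₂ p₂ x))).mul h2).congr_left ?_)
  · filter_upwards [eventually_gt_atTop 0] with x hx using (comm ν hν x hx).symm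
  · filter_upwards [eventually_gt_atTop 0] with x hx
    rw [Pi.mul_apply, zfun_swap hL₁ hp₁ hL₂ hp₂ hx, div_div_cancel₀ hx.ne',
      comm _ (ae_pos_weibullMeasure hL₂) x hx]
    congr 1
    refine setIntegral_congr_fun measurableSet_Ioi fun y hy => ?_
    exact weibullMeasure_real_Ioi hL₂ hp₂ (div_pos hx hy).le

/-! ### The density of the product -/

theorem lintegral_comp_mul_right_of_pos {y : ℝ} (hy : 0 < y) {φ : ℝ → ENNReal}
    (hφ : Measurable φ) :
    ∫⁻ x, φ x = ENNReal.ofReal y * ∫⁻ a, φ (a * y) := by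
  conv_lhs => rw [← Real.smul_map_volume_mul_right hy.ne']
  rw [lintegral_smul_measure, lintegral_map hφ (by fun_prop), abs_of_pos hy, smul_eq_mul]

/-- Tonelli together with the scaling `a ↦ a * y` at fixed `y` identifies the law; `D` takes
extended values so that no integrability is needed beforehand. -/
theorem isDensity_productDensity [IsProbabilityMeasure P] {X₁ X₂ : Ω → ℝ} (hX₁ : Measurable X₁)
    (hX₂ : Measurable X₂) (hindep : IndepFun X₁ X₂ P) (hpos : ∀ᵐ y ∂P.map X₂, 0 < y) {h₁ : ℝ → ℝ}
    (hd : IsDensity (P.map X₁) h₁) :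
    IsDensity (P.map fun ω => X₁ ω * X₂ ω) (productDensity h₁ (P.map X₂)) := by
  have i₁ := Measure.isProbabilityMeasure_map (μ := P) hX₁.aemeasurable
  have i₂ := Measure.isProbabilityMeasure_map (μ := P) hX₂.aemeasurable
  have i₃ := Measure.isProbabilityMeasure_map (μ := P) (hX₁.mul hX₂).aemeasurable
  set μ₂ := P.map X₂
  have hm := hd.measurable
  have hmeas : Measurable fun z : ℝ × ℝ => h₁ (z.1 / z.2) / z.2 :=
    (hm.comp (measurable_fst.div measurable_snd)).div measurable_snd
  have hmeas' : Measurable fun z : ℝ × ℝ => ENNReal.ofReal (h₁ (z.1 / z.2) / z.2) :=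
    ENNReal.measurable_ofReal.comp hmeas
  set D : ℝ → ENNReal := fun x => ∫⁻ y, ENNReal.ofReal (h₁ (x / y) / y) ∂μ₂ with hD
  have hDm : Measurable D := hmeas'.lintegral_prod_right'
  have hlaw : P.map (fun ω => X₁ ω * X₂ ω) = volume.withDensity D := by
    ext S hS
    rw [map_mul_eq hX₁ hX₂ hindep, Measure.map_apply (by fun_prop) hS,
      Measure.prod_apply_symm ((by fun_prop : Measurable fun z : ℝ × ℝ => z.1 * z.2) hS),
      withDensity_apply _ hS, hD,
      lintegral_lintegral_swap hmeas'.aemeasurable]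
    refine lintegral_congr_ae ?_
    filter_upwards [hpos] with y hy
    have hpre : MeasurableSet {a : ℝ | a * y ∈ S} :=
      (by fun_prop : Measurable fun a : ℝ => a * y) hS
    change P.map X₁ {a : ℝ | a * y ∈ S} = _
    rw [hd.eq_withDensity, withDensity_apply _ hpre, ← lintegral_indicator hS,
      ← lintegral_indicator hpre, lintegral_comp_mul_right_of_pos hy
        (φ := S.indicator fun x => ENNReal.ofReal (h₁ (x / y) / y))
        ((hmeas'.comp measurable_prodMk_right).indicator hS),
      ← lintegral_const_mul' _ _ ENNReal.ofReal_ne_top]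
    refine lintegral_congr fun a => ?_
    by_cases ha : a * y ∈ S
    · rw [Set.indicator_of_mem (show a ∈ {a : ℝ | a * y ∈ S} from ha), Set.indicator_of_mem ha,
        ← ENNReal.ofReal_mul hy.le, mul_div_cancel_right₀ _ hy.ne', mul_div_cancel₀ _ hy.ne']
    · rw [Set.indicator_of_notMem (show a ∉ {a : ℝ | a * y ∈ S} from ha),
        Set.indicator_of_notMem ha, mul_zero]
  have hpd : ∀ x, productDensity h₁ μ₂ x = (D x).toReal := by
    intro x
    have hx : Measurable fun y : ℝ => h₁ (x / y) / y := hmeas.comp measurable_prodMk_left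
    rw [productDensity, Measure.restrict_eq_self_of_ae_mem (s := Set.Ioi 0) hpos,
      integral_eq_lintegral_of_nonneg_ae ?_ hx.aestronglyMeasurable]
    filter_upwards [hpos] with y hy using div_nonneg (hd.nonneg _) hy.le
  -- `toReal` sends `⊤` to 0, so passing to the real version requires `D` finite almost everywhere;
  -- its total mass is 1.
  have hfin : ∀ᵐ x, D x < ⊤ := by
    refine ae_lt_top hDm ?_
    rw [← setLIntegral_univ, ← withDensity_apply _ MeasurableSet.univ, ← hlaw]
    exact measure_ne_top _ _
  refine ⟨?_, fun x => (hpd x).symm ▸ ENNReal.toReal_nonneg, ?_⟩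
  · rw [funext hpd]; exact hDm.ennreal_toReal
  · rw [hlaw]
    refine withDensity_congr_ae ?_
    filter_upwards [hfin] with x hx
    rw [hpd, ENNReal.ofReal_toReal hx.ne]

theorem IsDensity.ae_eq {μ : Measure ℝ} {f g : ℝ → ℝ} (hf : IsDensity μ f)
    (hg : IsDensity μ g) : f =ᵐ[volume] g := by
  have h := hf.eq_withDensity.symm.trans hg.eq_withDensity
  have h := (withDensity_eq_iff_of_sigmaFinite
    (ENNReal.measurable_ofReal.comp hf.measurable).aemeasurable
    (ENNReal.measurable_ofReal.comp hg.measurable).aemeasurable).1 h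
  filter_upwards [h] with x hx
  exact (ENNReal.ofReal_eq_ofReal_iff (hf.nonneg x) (hg.nonneg x)).1 hx

/-- If `h₁` is a density that behaves like `L p x ^ (p - 1)` times the tail, then `u * h₁ u` is a
Weibull-type kernel. -/
theorem IsWeibullType.weibullKernel_density {X : Ω → ℝ} {g : ℝ → ℝ} {α L p : ℝ}
    (h : IsWeibullType P X g α L p) (hg : UltimatelyMonotone g) {h₁ : ℝ → ℝ}
    (hm : Measurable h₁) (h0 : ∀ x, 0 ≤ h₁ x) (hb : ∃ M : ℝ, ∀ x, h₁ x ≤ M)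
    (he : h₁ ~[atTop] fun x => L * p * x ^ (p - 1) * tail P X x) :
    WeibullKernel (fun u => u * h₁ u) (fun u => L * p * u ^ p * g u) L p := by
  have hL := h.L_pos
  have hp := h.p_pos
  refine ⟨hL, hp, measurable_id.mul hm, fun u hu => mul_nonneg hu.le (h0 u),
    (intermediateRV_const_mul_rpow (mul_pos hL hp) hp).mul (h.regularlyVarying.intermediateRV hg),
    ?_, fun a => ?_⟩
  · have h1 := (IsEquivalent.refl (l := atTop) (u := fun u : ℝ => u)).mul (he.trans
      ((IsEquivalent.refl (u := fun x : ℝ => L * p * x ^ (p - 1))).mul h.tail_equiv))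
    refine h1.congr_right ?_
    filter_upwards [eventually_gt_atTop 0] with u hu
    simp only [Pi.mul_apply]
    rw [Real.rpow_sub_one hu.ne']
    field_simp
  · obtain ⟨M, hM⟩ := hb
    refine ⟨a * M, fun u hu hua => ?_⟩
    exact mul_le_mul hua (hM u) (h0 u) (hu.le.trans hua)

end WeibullProduct

theorem corollary2p2 {Ω : Type*} [MeasurableSpace Ω] (P : Measure Ω) [IsProbabilityMeasure P]
    (X₁ X₂ : Ω → ℝ) (g₁ g₂ : ℝ → ℝ) (α₁ α₂ L₁ L₂ p₁ p₂ : ℝ)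
    (hX₁ : WeibullProduct.IsWeibullType P X₁ g₁ α₁ L₁ p₁)
    (hX₂ : WeibullProduct.IsWeibullType P X₂ g₂ α₂ L₂ p₂)
    (hg₁ : WeibullProduct.UltimatelyMonotone g₁)
    (hg₂ : WeibullProduct.UltimatelyMonotone g₂)
    (hindep : IndepFun X₁ X₂ P) :
    -- the tail of the product
    ((WeibullProduct.tail P fun ω => X₁ ω * X₂ ω) ~[atTop] fun x =>
      (2 * Real.pi * p₂ * L₂ / (p₁ + p₂)) ^ (1 / 2 : ℝ) *
        WeibullProduct.constA L₁ p₁ L₂ p₂ ^ (p₂ / 2) *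
        x ^ (p₁ * p₂ / (2 * (p₁ + p₂))) *
        g₁ (x / WeibullProduct.zfun L₁ p₁ L₂ p₂ x) *
        g₂ (WeibullProduct.zfun L₁ p₁ L₂ p₂ x) *
        Real.exp (-WeibullProduct.constB L₁ p₁ L₂ p₂ * x ^ (p₁ * p₂ / (p₁ + p₂)))) ∧
    -- the density of the product
    ∀ h₁ : ℝ → ℝ, WeibullProduct.IsDensity (P.map X₁) h₁ →
      (∃ M : ℝ, ∀ x, h₁ x ≤ M) →
      WeibullProduct.UltimatelyDecreasing h₁ →
      (h₁ ~[atTop] fun x => L₁ * p₁ * x ^ (p₁ - 1) * WeibullProduct.tail P X₁ x) →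
      -- the usual version is given by a convergent integral for every positive argument,
      (∀ x : ℝ, 0 < x → IntegrableOn (fun y => h₁ (x / y) / y) (Set.Ioi 0) (P.map X₂)) ∧
      -- it is a density of the product,
      WeibullProduct.IsDensity (P.map fun ω => X₁ ω * X₂ ω)
        (WeibullProduct.productDensity h₁ (P.map X₂)) ∧
      -- it satisfies the claimed asymptotics,
      (WeibullProduct.productDensity h₁ (P.map X₂) ~[atTop] fun x =>
        L₁ * p₁ * WeibullProduct.constA L₁ p₁ L₂ p₂ ^ (-p₁) *
          x ^ (p₁ * p₂ / (p₁ + p₂) - 1) *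
          WeibullProduct.tail P (fun ω => X₁ ω * X₂ ω) x) ∧
      -- and so does, off a null set, every other version of the density.
      ∀ h : ℝ → ℝ, WeibullProduct.IsDensity (P.map fun ω => X₁ ω * X₂ ω) h →
        h ~[atTop ⊓ ae volume] fun x =>
          L₁ * p₁ * WeibullProduct.constA L₁ p₁ L₂ p₂ ^ (-p₁) *
            x ^ (p₁ * p₂ / (p₁ + p₂) - 1) *
            WeibullProduct.tail P (fun ω => X₁ ω * X₂ ω) x := by
  
  have hL₁ := hX₁.L_pos
  have hp₁ := hX₁.p_pos
  have hL₂ := hX₂.L_pos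
  have hp₂ := hX₂.p_pos
  have i₁ := Measure.isProbabilityMeasure_map (μ := P) hX₁.measurable.aemeasurable
  have i₂ := Measure.isProbabilityMeasure_map (μ := P) hX₂.measurable.aemeasurable
  have i₃ := Measure.isProbabilityMeasure_map (μ := P)
    (hX₁.measurable.mul hX₂.measurable).aemeasurable
  have hk₁ := hX₁.weibullKernel hg₁
  have hk₂ := hX₂.weibullKernel hg₂
  have hν := hk₂.weibullLaw hX₂.ae_pos_map
  have htail := (WeibullProduct.mixture_isEquivalent hk₁ hν).congr_left
    (Eventually.of_forall fun x => (WeibullProduct.tail_mul_eq hX₁.measurable hX₂.measurable hindep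
      hX₂.ae_pos_map x).symm)
  refine ⟨?_, fun h₁ hd hb _ he => ?_⟩
  · refine htail.trans (((IsEquivalent.refl (l := atTop)
      (u := fun x => g₁ (x / WeibullProduct.zfun L₁ p₁ L₂ p₂ x))).mul
      (WeibullProduct.weibull_mixture_isEquivalent hL₁ hp₁ hk₂ hX₂.ae_pos_map)).congr_right
      (Eventually.of_forall fun x => ?_))
    simp only [Pi.mul_apply]
    ring
  have hkd := hX₁.weibullKernel_density hg₁ hd.measurable hd.nonneg hb he
  -- This turns the density integral into `x⁻¹` times a mixture of the kernel `u * h₁ u`.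
  have hscale : ∀ x : ℝ, 0 < x → ∀ y ∈ Set.Ioi (0 : ℝ),
      h₁ (x / y) / y = x⁻¹ * (x / y * h₁ (x / y)) := by
    intro x hx y hy
    have hy : 0 < y := hy
    field_simp
  have hdens := WeibullProduct.isDensity_productDensity hX₁.measurable hX₂.measurable hindep
    hX₂.ae_pos_map hd
  have hasymp : WeibullProduct.productDensity h₁ (P.map X₂) ~[atTop] fun x =>
      L₁ * p₁ * WeibullProduct.constA L₁ p₁ L₂ p₂ ^ (-p₁) *
        x ^ (p₁ * p₂ / (p₁ + p₂) - 1) *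
        WeibullProduct.tail P (fun ω => X₁ ω * X₂ ω) x := by
    -- Density and tail freeze to the same pure integral and the same `g₁` factor; they differ by
    -- `x⁻¹ L₁ p₁ (x / z_x)^p₁`, which `div_zfun_rpow` evaluates.
    have h1 := (IsEquivalent.refl (l := atTop) (u := fun x : ℝ => x⁻¹)).mul
      (WeibullProduct.mixture_isEquivalent hkd hν)
    have h2 := (IsEquivalent.refl (l := atTop) (u := fun x : ℝ =>
      L₁ * p₁ * WeibullProduct.constA L₁ p₁ L₂ p₂ ^ (-p₁) *
        x ^ (p₁ * p₂ / (p₁ + p₂) - 1))).mul htail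
    refine ((h1.congr_left ?_).congr_right ?_).trans h2.symm
    · filter_upwards [eventually_gt_atTop 0] with x hx
      rw [WeibullProduct.productDensity, setIntegral_congr_fun measurableSet_Ioi (hscale x hx),
        integral_const_mul, Pi.mul_apply]
    · filter_upwards [eventually_gt_atTop 0] with x hx
      simp only [Pi.mul_apply]
      rw [WeibullProduct.div_zfun_rpow hL₁ hp₁ hL₂ hp₂ hx, Real.rpow_sub_one hx.ne']
      ring
  refine ⟨fun x hx => ?_, hdens, hasymp, fun h hh => ?_⟩
  · exact (integrableOn_congr_fun (hscale x hx) measurableSet_Ioi).2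
      ((WeibullProduct.integrableOn_kernel_div hkd _ hx).const_mul _)
  · refine (hasymp.mono inf_le_left).congr_left ?_
    exact (hdens.ae_eq hh).filter_mono inf_le_right
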